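/- Conventions. Baire space $\mathbb{N}^{\mathbb{N}}$ carries the product topology of discrete $\mathbb{N}$. A partial function $F:\subseteq\mathbb{N}^{\mathbb{N}}\to\mathbb{N}^{\mathbb{N}}$ is *computable* if some machine with a one-way output tape outputs $F(p)$ on every input $p\in\mathrm{dom}(F)$; it is *limit computable* if there is a machine with a two-way output tape which, on every input $p\in\mathrm{dom}(F)$, may revise its output, but such that for every output position $n$, after finitely many steps the content of cell $n$ is $F(p)(n)$ and is not changed anymore. (Nothing is required for inputs outside $\mathrm{dom}(F)$.) Put $\langle q,p\rangle(2n)=q(n)$, $\langle q,p\rangle(2n+1)=p(n)$, $\langle n,k\rangle=\frac12(n+k)(n+k+1)+k$ and $\langle p_0,p_1,\dots\rangle\langle n,k\rangle=p_n(k)$. $F$ is *computable relative to* $q\in\mathbb{N}^{\mathbb{N}}$ if there is a computable $G:\subseteq\mathbb{N}^{\mathbb{N}}\to\mathbb{N}^{\mathbb{N}}$ with $F(p)=G\langle q,p\rangle$ for all $p\in\mathrm{dom}(F)$. The Turing jump $\mathsf{J}:\mathbb{N}^{\mathbb{N}}\to\mathbb{N}^{\mathbb{N}}$ is given by $\mathsf{J}(p)(i)=1$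 if machine number $i$ (in a standard numbering) halts upon input $p$, and $\mathsf{J}(p)(i)=0$ otherwise; $0'=\mathsf{J}(000\dots)$ is the halting problem. The limit map $\lim:\subseteq\mathbb{N}^{\mathbb{N}}\to\mathbb{N}^{\mathbb{N}}$ sends $\langle p_0,p_1,p_2,\dots\rangle$ to $\lim_{i\to\infty}p_i$ and is defined exactly where this limit exists. For multi-valued partial functions $f:\subseteq X\rightrightarrows Y$ and $g:\subseteq Y\rightrightarrows Z$ (with $\mathrm{dom}(f)=\{x: f(x)\neq\emptyset\}$), the composition is $(g\circ f)(x)=\{z:(\exists y\in f(x))\ z\in g(y)\}$ with $\mathrm{dom}(g\circ f)=\{x\in\mathrm{dom}(f): f(x)\subseteq\mathrm{dom}(g)\}$. Let $\lim^{-1}(p)=\{q:\lim(q)=p\}$ and $\mathsf{H}=\mathsf{J}\circ\lim^{-1}:\mathbb{N}^{\mathbb{N}}\rightrightarrows\mathbb{N}^{\mathbb{N}}$. Equality of partial (multi-valued) functions includes equality of domains; a single-valued partial function is viewed as a multi-valued one. Theorem. For every partial function $F:\subseteq\mathbb{N}^{\mathbb{N}}\to\mathbb{N}^{\mathbb{N}}$: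 (1) $F$ is computable relative to the halting problem $0'$ if and only if there is a computable $G:\subseteq\mathbb{N}^{\mathbb{N}}\to\mathbb{N}^{\mathbb{N}}$ such that $F=G\circ\mathsf{H}$. (2) $F$ is computable relative to the halting problem $0'$ if and only if $F\circ G$ is limit computable for every limit computable $G:\subseteq\mathbb{N}^{\mathbb{N}}\to\mathbb{N}^{\mathbb{N}}$. -/

import Mathlib

namespace LimitComp

open Filter Topology

/-- The set `ℕ^ℕ`; as a function type it carries the product topology of discrete `ℕ`
(Baire space). -/
abbrev Baire : Type := ℕ → ℕ

/-! ## Machines that have access to an infinite input `p ∈ ℕ^ℕ` -/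

/-- Programs of machines with an infinite input: programs for partial recursive functions with
the additional instruction `oracle` that reads the input sequence at a computed position. -/
inductive Code : Type
  | zero : Code
  | succ : Code
  | left : Code
  | right : Code
  | oracle : Code
  | pair : Code → Code → Code
  | comp : Code → Code → Code
  | prec : Code → Code → Code
  | rfind' : Code → Code

namespace Code

/-- `eval p c` is the partial function on natural numbers that the program `c` computes on the
infinite input `p`. The value is undefined iff the computation does not halt. Apart from `oracle`
this is the semantics of `Nat.Partrec.Code`. -/
def eval (p : Baire) : Code → ℕ →. ℕ
  | zero => pure 0
  | succ => Nat.succ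
  | left => ↑fun n : ℕ => n.unpair.1
  | right => ↑fun n : ℕ => n.unpair.2
  | oracle => ↑p
  | pair cf cg => fun n => Nat.pair <$> eval p cf n <*> eval p cg n
  | comp cf cg => fun n => eval p cg n >>= eval p cf
  | prec cf cg =>
    Nat.unpaired fun a n =>
      n.rec (eval p cf a) fun y IH => do
        let i ← IH
        eval p cg (Nat.pair a (Nat.pair y i))
  | rfind' cf =>
    Nat.unpaired fun a m =>
      (Nat.rfind fun n => (fun m => m = 0) <$> eval p cf (Nat.pair a (n + m))).map (· + m)

/-- The number of a program. -/
def encodeCode : Code → ℕ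
  | zero => 0
  | succ => 1
  | left => 2
  | right => 3
  | oracle => 4
  | pair cf cg => 2 * (2 * Nat.pair (encodeCode cf) (encodeCode cg)) + 5
  | comp cf cg => 2 * (2 * Nat.pair (encodeCode cf) (encodeCode cg) + 1) + 5
  | prec cf cg => (2 * (2 * Nat.pair (encodeCode cf) (encodeCode cg)) + 1) + 5
  | rfind' cf => (2 * (2 * encodeCode cf + 1) + 1) + 5

/-- The program with number `i`. -/
def ofNatCode : ℕ → Code
  | 0 => zero
  | 1 => succ
  | 2 => left
  | 3 => right
  | 4 => oracle
  | n + 5 =>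
    let m := n.div2.div2
    have hm : m < n + 5 := by
      simp only [m, Nat.div2_val]
      exact
        lt_of_le_of_lt (le_trans (Nat.div_le_self _ _) (Nat.div_le_self _ _))
          (Nat.lt_add_of_pos_right (by decide))
    have _m1 : m.unpair.1 < n + 5 := lt_of_le_of_lt m.unpair_left_le hm
    have _m2 : m.unpair.2 < n + 5 := lt_of_le_of_lt m.unpair_right_le hm
    match n.bodd, n.div2.bodd with
    | false, false => pair (ofNatCode m.unpair.1) (ofNatCode m.unpair.2)
    | false, true => comp (ofNatCode m.unpair.1) (ofNatCode m.unpair.2)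
    | true, false => prec (ofNatCode m.unpair.1) (ofNatCode m.unpair.2)
    | true, true => rfind' (ofNatCode m)
decreasing_by
  all_goals first | exact _m1 | exact _m2 | exact hm

theorem ofNatCode_encodeCode (c : Code) : ofNatCode (encodeCode c) = c := by
  induction c <;> simp [encodeCode, ofNatCode, Nat.div2_val, *]

theorem encodeCode_ofNatCode : ∀ n, encodeCode (ofNatCode n) = n
  | 0 => by simp [ofNatCode, encodeCode]
  | 1 => by simp [ofNatCode, encodeCode]
  | 2 => by simp [ofNatCode, encodeCode]
  | 3 => by simp [ofNatCode, encodeCode]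
  | 4 => by simp [ofNatCode, encodeCode]
  | n + 5 => by
    let m := n.div2.div2
    have hm : m < n + 5 := by
      simp only [m, Nat.div2_val]
      exact
        lt_of_le_of_lt (le_trans (Nat.div_le_self _ _) (Nat.div_le_self _ _))
          (Nat.lt_add_of_pos_right (by decide))
    have _m1 : m.unpair.1 < n + 5 := lt_of_le_of_lt m.unpair_left_le hm
    have _m2 : m.unpair.2 < n + 5 := lt_of_le_of_lt m.unpair_right_le hm
    have IH := encodeCode_ofNatCode m
    have IH1 := encodeCode_ofNatCode m.unpair.1
    have IH2 := encodeCode_ofNatCode m.unpair.2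
    conv_rhs => rw [← Nat.bit_bodd_div2 n, ← Nat.bit_bodd_div2 n.div2]
    simp only [ofNatCode.eq_6]
    cases n.bodd <;> cases n.div2.bodd <;>
      simp [m, encodeCode, IH, IH1, IH2, Nat.bit_val]
decreasing_by
  all_goals first | exact _m1 | exact _m2 | exact hm

/-- The numbering of programs is a bijection with `ℕ`. -/
instance instDenumerable : Denumerable Code :=
  Denumerable.mk' ⟨encodeCode, ofNatCode, ofNatCode_encodeCode, encodeCode_ofNatCode⟩

end Code

/-- The machine with program `c` halts upon input `p` (it is started with the number `0`). -/
def HaltsOn (c : Code) (p : Baire) : Prop := (c.eval p 0).Dom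

/-! ## Computable and limit computable partial functions on `ℕ^ℕ` -/

/-- `F :⊆ ℕ^ℕ → ℕ^ℕ` is computable: some machine outputs the sequence `F p` symbol by symbol
(its `n`-th output symbol, which is final, is `eval p c n`) for every input `p ∈ dom F`. There is
no requirement on inputs outside of `dom F`. -/
def IsComputable (F : Baire →. Baire) : Prop :=
  ∃ c : Code, ∀ p, ∀ h : (F p).Dom, ∀ n, (F p).get h n ∈ c.eval p n

/-- The content of cell `n` of the output tape after `t` time steps, if the output actions
`a 0, a 1, …` are performed, one in each step. The tape is initially blank (`none`). The action
`0` leaves the tape unchanged; the action `k + 1`, with `k = Nat.pair m v`, writes `v` into cell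
`m`, overwriting the previous content. -/
def tapeContent (a : ℕ → ℕ) (n : ℕ) : ℕ → Option ℕ
  | 0 => none
  | t + 1 =>
    match a t with
    | 0 => tapeContent a n t
    | k + 1 => if k.unpair.1 = n then some k.unpair.2 else tapeContent a n t

/-- `F :⊆ ℕ^ℕ → ℕ^ℕ` is limit computable: there is a machine with a two-way output tape (whose
program computes its output action `a s` in step `s` from the input `p`) such that for every input
`p ∈ dom F` and every output position `n`, after finitely many steps cell `n` contains `F p n` and
is not changed anymore. -/
def IsLimitComputable (F : Baire →. Baire) : Prop :=
  ∃ c : Code, ∀ p, ∀ h : (F p).Dom,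
    ∃ a : ℕ → ℕ, (∀ s, a s ∈ c.eval p s) ∧
      ∀ n, ∃ T, ∀ t, T ≤ t → tapeContent a n t = some ((F p).get h n)

/-- The pairing `⟨q, p⟩` with `⟨q, p⟩(2n) = q n` and `⟨q, p⟩(2n+1) = p n`. -/
def join (q p : Baire) : Baire := fun n => if n % 2 = 0 then q (n / 2) else p (n / 2)

/-- `F` is computable relative to the oracle `q`: there is a computable `G` such that
`F p = G ⟨q, p⟩` for all `p ∈ dom F`. -/
def IsComputableRelativeTo (q : Baire) (F : Baire →. Baire) : Prop :=
  ∃ G : Baire →. Baire, IsComputable G ∧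
    ∀ p, ∀ h : (F p).Dom, (F p).get h ∈ G (join q p)

/-! ## Multi-valued functions -/

/-- Multi-valued partial functions `f :⊆ X ⇉ Y`, given by the sets `f x` of possible values; `f` is
undefined at `x` iff `f x = ∅`. -/
abbrev Multi (X Y : Type) : Type := X → Set Y

namespace Multi

variable {X Y Z : Type}

/-- The domain of a multi-valued function. -/
def dom (f : Multi X Y) : Set X := {x | (f x).Nonempty}

/-- The composition `g ∘ f`, with `dom (g ∘ f) = {x ∈ dom f | f x ⊆ dom g}`. -/
def comp (g : Multi Y Z) (f : Multi X Y) : Multi X Z :=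
  fun x => {z | (x ∈ f.dom ∧ f x ⊆ g.dom) ∧ ∃ y ∈ f x, z ∈ g y}

/-- The inverse `f⁻¹` of a multi-valued function. -/
def inverse (f : Multi X Y) : Multi Y X := fun y => {x | y ∈ f x}

/-- A single-valued partial function, seen as a multi-valued one. -/
def ofPFun (f : X →. Y) : Multi X Y := fun x => {y | y ∈ f x}

end Multi

/-! ## The Turing jump, the limit map and `H = J ∘ lim⁻¹` -/

open Classical in
/-- The Turing jump `J : ℕ^ℕ → ℕ^ℕ`. -/
noncomputable def jump (p : Baire) : Baire :=
  fun i => if HaltsOn (Denumerable.ofNat Code i) p then 1 else 0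

/-- The halting problem `0'`, the jump of the constant zero sequence. -/
noncomputable def haltingProblem : Baire := jump fun _ => 0

/-- The Cantor pairing `⟨n, k⟩ = (n + k)(n + k + 1)/2 + k`. -/
def cantorPair (n k : ℕ) : ℕ := (n + k) * (n + k + 1) / 2 + k

/-- The sequence `p_i` in `q = ⟨p_0, p_1, p_2, …⟩`, where `⟨p_0, p_1, …⟩⟨i, k⟩ = p_i k`. -/
def row (q : Baire) (i : ℕ) : Baire := fun k => q (cantorPair i k)

/-- The partial map `lim` that sends `⟨p_0, p_1, p_2, …⟩` to the limit of `p_i` in Baire space; its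
domain is the set of all `⟨p_0, p_1, p_2, …⟩` for which this limit exists. -/
noncomputable def limMap : Baire →. Baire := fun q =>
  ⟨∃ p, Tendsto (row q) atTop (𝓝 p), fun h => h.choose⟩

/-- The multi-valued function `H = J ∘ lim⁻¹`. -/
noncomputable def H : Multi Baire Baire :=
  Multi.comp (Multi.ofPFun (jump : Baire →. Baire)) (Multi.inverse (Multi.ofPFun limMap))

end LimitComp

/-! Both equivalences follow from one cycle: computability relative to `0'` gives limit
computability of `F ∘ G` for all limit computable `G`, in particular for `lim`; this gives `F = G ∘
H` with `G` computable; and this gives computability relative to `0'`.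

For the first implication, approximate `0'` from below and the output of the inner machine by its
current tape, and run the program for `F` on these finite approximations. A halting computation uses
a finite part of its oracle, so its value is final once that part is correct (`run_mono`,
`eventually_approxOracle`).

For the second, a limit computable map is computable from the jump of its input: that a given step
writes `v`, and that a later step writes something else, are both semidecidable
(`exists_code_jump`). Applied to `F ∘ lim`, this gives `G (J q) = F (lim q)`; injectivity of `J`
makes `G` well defined with exactly the required domain.

The third rests on `exists_low_preimage`: every `p` equals `lim q` for some `q` with `J q` uniformly
computable from `⟨0', p⟩`. This is a finite extension argument. At stage `i` the columns `k < i` are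
frozen to `p k`, and `0'` is asked whether an admissible finite extension makes program `i` halt; if
so, one is taken. Freezing forces `lim q = p`, the answers are the bits of `J q`, and then `F p = G
(J q)`. -/

namespace LimitComp

open Filter Topology

/-! ### Programs with partial oracles -/

namespace Code

/-- The semantics of programs with a partial oracle. -/
def evalWith (o : ℕ →. ℕ) : Code → ℕ →. ℕ
  | zero => pure 0
  | succ => Nat.succ
  | left => ↑fun n : ℕ => n.unpair.1
  | right => ↑fun n : ℕ => n.unpair.2
  | oracle => o
  | pair cf cg => fun n => Nat.pair <$> evalWith o cf n <*> evalWith o cg n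
  | comp cf cg => fun n => evalWith o cg n >>= evalWith o cf
  | prec cf cg =>
    Nat.unpaired fun a n =>
      n.rec (evalWith o cf a) fun y IH => do
        let i ← IH
        evalWith o cg (Nat.pair a (Nat.pair y i))
  | rfind' cf =>
    Nat.unpaired fun a m =>
      (Nat.rfind fun n => (fun m => m = 0) <$> evalWith o cf (Nat.pair a (n + m))).map (· + m)

theorem eval_eq_evalWith (p : Baire) (c : Code) : eval p c = evalWith (p : ℕ →. ℕ) c := by
  induction c with
  | zero | succ | left | right | oracle => rfl
  | pair cf cg hf hg => rw [eval, hf, hg]; rfl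
  | comp cf cg hf hg => rw [eval, hf, hg]; rfl
  | prec cf cg hf hg => rw [eval, hf, hg]; rfl
  | rfind' cf hf => rw [eval, hf]; rfl

section

variable (o : ℕ →. ℕ) (cf cg : Code)

theorem evalWith_pair (n : ℕ) : evalWith o (pair cf cg) n =
    (evalWith o cf n).bind fun x => (evalWith o cg n).map (Nat.pair x) := by
  change ((evalWith o cf n).map Nat.pair).bind (fun f => (evalWith o cg n).map f) = _
  simp [Part.bind_map]

theorem evalWith_comp (n : ℕ) :
    evalWith o (comp cf cg) n = (evalWith o cg n).bind fun x => evalWith o cf x := rfl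

theorem evalWith_prec (n : ℕ) : evalWith o (prec cf cg) n =
    n.unpair.2.rec (evalWith o cf n.unpair.1) fun y IH =>
      IH.bind fun i => evalWith o cg (Nat.pair n.unpair.1 (Nat.pair y i)) := rfl

theorem evalWith_rfind' (n : ℕ) : evalWith o (rfind' cf) n =
    (Nat.rfind fun k => (evalWith o cf (Nat.pair n.unpair.1 (k + n.unpair.2))).map
      (fun m => decide (m = 0))).map (· + n.unpair.2) := rfl

theorem mem_evalWith_pair {n v : ℕ} : v ∈ evalWith o (pair cf cg) n ↔
    ∃ x ∈ evalWith o cf n, ∃ y ∈ evalWith o cg n, Nat.pair x y = v := by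
  simp only [evalWith_pair, Part.mem_bind_iff, Part.mem_map_iff]

theorem mem_evalWith_comp {n v : ℕ} :
    v ∈ evalWith o (comp cf cg) n ↔ ∃ x ∈ evalWith o cg n, v ∈ evalWith o cf x := by
  simp only [evalWith_comp, Part.mem_bind_iff]

theorem mem_evalWith_rfind' {n v : ℕ} : v ∈ evalWith o (rfind' cf) n ↔
    ∃ k, 0 ∈ evalWith o cf (Nat.pair n.unpair.1 (k + n.unpair.2)) ∧
      (∀ m < k, ∃ y ∈ evalWith o cf (Nat.pair n.unpair.1 (m + n.unpair.2)), y ≠ 0) ∧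
      k + n.unpair.2 = v := by
  simp only [evalWith_rfind', Part.mem_map_iff]
  refine exists_congr fun k => ?_
  rw [← and_assoc]
  refine and_congr_left' (Nat.mem_rfind.trans ?_)
  simp [Part.mem_map_iff]

end

/-- A halting computation survives any enlargement of the graph of the oracle. Partial oracles let
this cover both finite prefixes and oracles that are themselves computed by a program. -/
theorem evalWith_mono {o o' : ℕ →. ℕ} (ho : ∀ n v, v ∈ o n → v ∈ o' n) (c : Code) :
    ∀ n v, v ∈ evalWith o c n → v ∈ evalWith o' c n := by
  induction c with
  | zero | succ | left | right => exact fun n v h => h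
  | oracle => exact ho
  | pair cf cg hf hg =>
    intro n v h
    rw [mem_evalWith_pair] at h ⊢
    obtain ⟨x, hx, y, hy, rfl⟩ := h
    exact ⟨x, hf _ _ hx, y, hg _ _ hy, rfl⟩
  | comp cf cg hf hg =>
    intro n v h
    rw [mem_evalWith_comp] at h ⊢
    obtain ⟨x, hx, hv⟩ := h
    exact ⟨x, hg _ _ hx, hf _ _ hv⟩
  | prec cf cg hf hg =>
    intro n v h
    rw [evalWith_prec] at h ⊢
    generalize n.unpair.2 = k at h ⊢
    induction k generalizing v with
    | zero => exact hf _ _ h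
    | succ k ih =>
      obtain ⟨x, hx, hv⟩ := Part.mem_bind_iff.1 h
      exact Part.mem_bind_iff.2 ⟨x, ih _ hx, hg _ _ hv⟩
  | rfind' cf hf =>
    intro n v h
    rw [mem_evalWith_rfind'] at h ⊢
    obtain ⟨k, h0, hk, rfl⟩ := h
    refine ⟨k, hf _ _ h0, fun m hm => ?_, rfl⟩
    obtain ⟨y, hy, hy0⟩ := hk m hm
    exact ⟨y, hf _ _ hy, hy0⟩

end Code

/-! ### Finite prefixes of the oracle and the use principle -/

/-- The first `s` values of `p`. -/
def pre (p : Baire) (s : ℕ) : List ℕ := (List.range s).map p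

@[simp] theorem pre_length (p : Baire) (s : ℕ) : (pre p s).length = s := by simp [pre]

theorem pre_succ (p : Baire) (s : ℕ) : pre p (s + 1) = pre p s ++ [p s] := by
  simp [pre, List.range_succ]

theorem pre_getElem? (p : Baire) {s i : ℕ} (h : i < s) : (pre p s)[i]? = some (p i) := by
  simp [pre, h]

theorem eq_of_pre_getElem? {p : Baire} {s i v : ℕ} (h : (pre p s)[i]? = some v) : p i = v := by
  have hi : i < s := by simpa using (List.getElem?_eq_some_iff.1 h).1
  simpa [pre_getElem? p hi] using h

theorem take_pre (p : Baire) (s t : ℕ) : (pre p s).take t = pre p (min t s) := by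
  simp [pre, ← List.map_take, List.take_range]

theorem pre_prefix (p : Baire) {s t : ℕ} (h : s ≤ t) : pre p s <+: pre p t := by
  have : pre p s = (pre p t).take s := by rw [take_pre, min_eq_left h]
  rw [this]; exact List.take_prefix _ _

/-- A finite sequence as a partial oracle. -/
def listOracle (l : List ℕ) : ℕ →. ℕ := fun n => (l[n]? : Option ℕ)

theorem mem_listOracle {l : List ℕ} {n v : ℕ} : v ∈ listOracle l n ↔ l[n]? = some v := by
  simp [listOracle]

theorem Code.mem_eval_of_listOracle {p : Baire} {s : ℕ} {c : Code} {n v : ℕ}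
    (h : v ∈ evalWith (listOracle (pre p s)) c n) : v ∈ eval p c n := by
  rw [eval_eq_evalWith]
  refine evalWith_mono (fun n v h => ?_) c n v h
  rw [mem_listOracle] at h
  simp [eq_of_pre_getElem? h]

/-- Use principle: a halting computation queries finitely many oracle positions. With `∀ᶠ` the
bounds for subcomputations combine by intersection, including the finitely many tests of a
minimisation. -/
theorem Code.eventually_listOracle {p : Baire} (c : Code) : ∀ {n v : ℕ}, v ∈ eval p c n →
    ∀ᶠ s in atTop, v ∈ evalWith (listOracle (pre p s)) c n := by
  rw [eval_eq_evalWith]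
  induction c with
  | zero | succ | left | right => exact fun h => Eventually.of_forall fun _ => h
  | oracle =>
    intro n v h
    filter_upwards [eventually_gt_atTop n] with s hs
    simp only [evalWith, PFun.coe_val, Part.mem_some_iff] at h ⊢
    rw [mem_listOracle, pre_getElem? p hs, h]
  | pair cf cg hf hg =>
    intro n v h
    simp only [mem_evalWith_pair] at h ⊢
    obtain ⟨x, hx, y, hy, rfl⟩ := h
    filter_upwards [hf hx, hg hy] with s h1 h2
    exact ⟨x, h1, y, h2, rfl⟩
  | comp cf cg hf hg =>
    intro n v h
    simp only [mem_evalWith_comp] at h ⊢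
    obtain ⟨x, hx, hv⟩ := h
    filter_upwards [hg hx, hf hv] with s h1 h2
    exact ⟨x, h1, h2⟩
  | prec cf cg hf hg =>
    intro n v h
    simp only [evalWith_prec] at h ⊢
    generalize n.unpair.2 = k at h ⊢
    induction k generalizing v with
    | zero => exact hf h
    | succ k ih =>
      obtain ⟨x, hx, hv⟩ := Part.mem_bind_iff.1 h
      filter_upwards [ih hx, hg hv] with s h1 h2
      exact Part.mem_bind_iff.2 ⟨x, h1, h2⟩
  | rfind' cf hf =>
    intro n v h
    simp only [mem_evalWith_rfind'] at h ⊢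
    obtain ⟨k, h0, hk, rfl⟩ := h
    have : ∀ᶠ s in atTop, ∀ m ∈ Set.Iio k, ∃ y ∈ evalWith (listOracle (pre p s)) cf
        (Nat.pair n.unpair.1 (m + n.unpair.2)), y ≠ 0 := by
      refine (Filter.eventually_all_finite (Set.finite_Iio k)).2 fun m hm => ?_
      obtain ⟨y, hy, hy0⟩ := hk m hm
      filter_upwards [hf hy] with s h1
      exact ⟨y, h1, hy0⟩
    filter_upwards [hf h0, this] with s h1 h2
    exact ⟨k, h1, h2, rfl⟩

/-! ### Translation into programs without oracle -/

namespace Code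

section

variable (cf cg : Nat.Partrec.Code)

theorem _root_.Nat.Partrec.Code.eval_pair (n : ℕ) : (Nat.Partrec.Code.pair cf cg).eval n =
    (cf.eval n).bind fun x => (cg.eval n).map (Nat.pair x) := by
  change ((cf.eval n).map Nat.pair).bind (fun f => (cg.eval n).map f) = _
  simp [Part.bind_map]

theorem _root_.Nat.Partrec.Code.eval_comp (n : ℕ) :
    (Nat.Partrec.Code.comp cf cg).eval n = (cg.eval n).bind fun x => cf.eval x := rfl

theorem _root_.Nat.Partrec.Code.eval_prec (n : ℕ) : (Nat.Partrec.Code.prec cf cg).eval n =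
    n.unpair.2.rec (cf.eval n.unpair.1) fun y IH =>
      IH.bind fun i => cg.eval (Nat.pair n.unpair.1 (Nat.pair y i)) := rfl

theorem _root_.Nat.Partrec.Code.eval_rfind' (n : ℕ) : (Nat.Partrec.Code.rfind' cf).eval n =
    (Nat.rfind fun k => (cf.eval (Nat.pair n.unpair.1 (k + n.unpair.2))).map
      (fun m => decide (m = 0))).map (· + n.unpair.2) := rfl

theorem _root_.Nat.Partrec.Code.eval_left (n : ℕ) :
    Nat.Partrec.Code.left.eval n = Part.some n.unpair.1 := rfl

theorem _root_.Nat.Partrec.Code.eval_right (n : ℕ) :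
    Nat.Partrec.Code.right.eval n = Part.some n.unpair.2 := rfl

end

/-- Translation into an oracle free program that receives the oracle as the first component of its
input; `l` is the program that looks up the values of the oracle. -/
def translate (l : Nat.Partrec.Code) : LimitComp.Code → Nat.Partrec.Code
  | zero => .zero
  | succ => .comp .succ .right
  | left => .comp .left .right
  | right => .comp .right .right
  | oracle => l
  | pair cf cg => .pair (translate l cf) (translate l cg)
  | comp cf cg => .comp (translate l cf) (.pair .left (translate l cg))
  | prec cf cg => .comp (.prec (translate l cf) (.comp (translate l cg)
      (.pair (.comp .left .left) (.pair (.comp .right .left) .right))))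
      (.pair (.pair .left (.comp .left .right)) (.comp .right .right))
  | rfind' cf => .comp (.rfind' (.comp (translate l cf)
      (.pair (.comp .left .left) (.pair (.comp .right .left) .right))))
      (.pair (.pair .left (.comp .left .right)) (.comp .right .right))

/-- The code `σ` travels along as an extra parameter. In `prec` and `rfind'` it joins the parameter
`a` as `(σ, a)`, and the bodies reassociate `((σ, a), z)` to `(σ, (a, z))`. -/
theorem eval_translate {l : Nat.Partrec.Code} {σ : ℕ} {o : ℕ →. ℕ}
    (ho : ∀ i, l.eval (Nat.pair σ i) = o i) (c : LimitComp.Code) : ∀ n,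
    (translate l c).eval (Nat.pair σ n) = evalWith o c n := by
  open Nat.Partrec.Code in
  induction c with
  | zero => exact fun n => rfl
  | succ | left | right =>
    intro n
    simp only [translate, Nat.Partrec.Code.eval_comp, eval_right, Nat.unpair_pair, Part.bind_some]
    rfl
  | oracle => exact ho
  | pair cf cg hf hg => intro n; rw [translate, Nat.Partrec.Code.eval_pair, hf, hg, evalWith_pair]
  | comp cf cg hf hg =>
    intro n
    simp only [translate, Nat.Partrec.Code.eval_comp, Nat.Partrec.Code.eval_pair, eval_left, hg,
      Nat.unpair_pair, Part.bind_some, Part.bind_map, hf, evalWith_comp]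
  | prec cf cg hf hg =>
    intro n
    simp only [translate, Nat.Partrec.Code.eval_comp, Nat.Partrec.Code.eval_pair, eval_left, hg,
      Nat.Partrec.Code.eval_prec, eval_right, Nat.unpair_pair, Part.bind_some, Part.map_some, hf,
      evalWith_prec]
  | rfind' cf hf =>
    intro n
    simp only [translate, Nat.Partrec.Code.eval_comp, Nat.Partrec.Code.eval_pair, eval_left, hf,
      Nat.Partrec.Code.eval_rfind', eval_right, Nat.unpair_pair, Part.bind_some, Part.map_some,
      evalWith_rfind']

open Nat.Partrec.Code in
-- Course-of-values recursion on program numbers, since the numbers of subprograms are smaller. It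
-- makes step-bounded evaluation primitive recursive in the program number too, via `evaln`.
theorem primrec_translate (l : Nat.Partrec.Code) : Primrec fun i => translate l (ofNatCode i) := by
  let rearr : Nat.Partrec.Code := .pair (.comp .left .left) (.pair (.comp .right .left) .right)
  let rearr' : Nat.Partrec.Code :=
    .pair (.pair .left (.comp .left .right)) (.comp .right .right)
  -- `L` lists the translations of all smaller numbers. Here `a` serves `rfind'`, and `b`, `c` serve
  -- the binary constructors; all three are looked up in every case.
  let step (L : List Nat.Partrec.Code) (n : ℕ) : Option Nat.Partrec.Code :=
    (L[n.div2.div2]?).bind fun a => (L[n.div2.div2.unpair.1]?).bind fun b =>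
      (L[n.div2.div2.unpair.2]?).map fun c =>
        bif n.bodd then bif n.div2.bodd then .comp (.rfind' (.comp a rearr)) rearr'
          else .comp (.prec b (.comp c rearr)) rearr'
        else bif n.div2.bodd then .comp b (.pair .left c) else .pair b c
  let g (L : List Nat.Partrec.Code) : Option Nat.Partrec.Code :=
    if L.length < 5 then
      [Nat.Partrec.Code.zero, .comp .succ .right, .comp .left .right, .comp .right .right,
        l][L.length]?
    else step L (L.length - 5)
  have hstep : Primrec₂ step := by
    have hn : Primrec fun x : List Nat.Partrec.Code × ℕ => x.2.div2.div2 :=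
      Primrec.nat_div2.comp (Primrec.nat_div2.comp Primrec.snd)
    refine Primrec.option_bind (Primrec.list_getElem?.comp Primrec.fst hn) ?_
    refine Primrec.option_bind (Primrec.list_getElem?.comp (Primrec.fst.comp Primrec.fst)
      (Primrec.fst.comp (Primrec.unpair.comp (hn.comp Primrec.fst)))) ?_
    refine Primrec.option_map (Primrec.list_getElem?.comp
      (Primrec.fst.comp (Primrec.fst.comp Primrec.fst))
      (Primrec.snd.comp (Primrec.unpair.comp (hn.comp (Primrec.fst.comp Primrec.fst))))) ?_
    have h0 : Primrec fun x : (((List Nat.Partrec.Code × ℕ) × Nat.Partrec.Code) ×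
        Nat.Partrec.Code) × Nat.Partrec.Code => x.1.1.1.2 :=
      Primrec.snd.comp (Primrec.fst.comp (Primrec.fst.comp Primrec.fst))
    have ha : Primrec fun x : (((List Nat.Partrec.Code × ℕ) × Nat.Partrec.Code) ×
        Nat.Partrec.Code) × Nat.Partrec.Code => x.1.1.2 :=
      Primrec.snd.comp (Primrec.fst.comp Primrec.fst)
    have hb : Primrec fun x : (((List Nat.Partrec.Code × ℕ) × Nat.Partrec.Code) ×
        Nat.Partrec.Code) × Nat.Partrec.Code => x.1.2 :=
      Primrec.snd.comp Primrec.fst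
    have hc : Primrec fun x : (((List Nat.Partrec.Code × ℕ) × Nat.Partrec.Code) ×
        Nat.Partrec.Code) × Nat.Partrec.Code => x.2 := Primrec.snd
    refine Primrec.cond (Primrec.nat_bodd.comp h0)
      (Primrec.cond (Primrec.nat_bodd.comp (Primrec.nat_div2.comp h0)) ?_ ?_)
      (Primrec.cond (Primrec.nat_bodd.comp (Primrec.nat_div2.comp h0)) ?_ ?_)
    · exact primrec₂_comp.comp (primrec_rfind'.comp (primrec₂_comp.comp ha (Primrec.const _)))
        (Primrec.const _)
    · exact primrec₂_comp.comp (primrec₂_prec.comp hb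
        (primrec₂_comp.comp hc (Primrec.const _))) (Primrec.const _)
    · exact primrec₂_comp.comp hb (primrec₂_pair.comp (Primrec.const _) hc)
    · exact primrec₂_pair.comp hb hc
  have hg : Primrec g :=
    Primrec.ite (Primrec.nat_lt.comp Primrec.list_length (Primrec.const 5))
      (Primrec.list_getElem?.comp (Primrec.const _) Primrec.list_length)
      (hstep.comp Primrec.id (Primrec.nat_sub.comp Primrec.list_length (Primrec.const 5)))
  have := Primrec.nat_strong_rec (fun (_ : Unit) n => translate l (ofNatCode n))
    (g := fun _ L => g L) (hg.comp Primrec.snd) ?_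
  · exact this.comp (Primrec.const ()) Primrec.id
  intro _ n
  match n with
  | 0 | 1 | 2 | 3 | 4 => simp [g, ofNatCode, translate]
  | n + 5 =>
    have hm : n.div2.div2 < n + 5 := by
      simp only [Nat.div2_val]; omega
    have h1 : n.div2.div2.unpair.1 < n + 5 := lt_of_le_of_lt (Nat.unpair_left_le _) hm
    have h2 : n.div2.div2.unpair.2 < n + 5 := lt_of_le_of_lt (Nat.unpair_right_le _) hm
    simp only [g, step, List.length_map, List.length_range, List.getElem?_map,
      List.getElem?_range hm, List.getElem?_range h1, List.getElem?_range h2,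
      show ¬ n + 5 < 5 by omega, if_false, Nat.add_sub_cancel, Option.map_some, Option.bind_some,
      ofNatCode]
    cases n.bodd <;> cases n.div2.bodd <;> rfl

end Code

/-! ### Step bounded evaluation with a finite part of the oracle -/

theorem exists_lookupCode : ∃ l : Nat.Partrec.Code, ∀ (σ : List ℕ) i,
    l.eval (Nat.pair (Encodable.encode σ) i) = listOracle σ i := by
  have h : Computable fun n : ℕ => (Denumerable.ofNat (List ℕ) n.unpair.1)[n.unpair.2]? :=
    (Primrec.list_getElem?.comp ((Primrec.ofNat _).comp (Primrec.fst.comp Primrec.unpair))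
      (Primrec.snd.comp Primrec.unpair)).to_comp
  obtain ⟨l, hl⟩ := Nat.Partrec.Code.exists_code.1 (Partrec.nat_iff.1 h.ofOption)
  refine ⟨l, fun σ i => ?_⟩
  rw [hl]
  simp [listOracle]

/-- A program that looks up the entries of a finite sequence. -/
noncomputable def lookupCode : Nat.Partrec.Code := exists_lookupCode.choose

/-- One attempt to run program `i` on input `n` with the finite oracle `σ`; the length of `σ`
encodes the part of `σ` that is used and the number of steps. -/
noncomputable def runOnce (σ : List ℕ) (i n : ℕ) : Option ℕ :=
  Nat.Partrec.Code.evaln σ.length.unpair.2 (Code.translate lookupCode (Code.ofNatCode i))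
    (Nat.pair (Encodable.encode (σ.take σ.length.unpair.1)) n)

/-- Bounded run of program `i` on input `n` with the finite oracle `σ`. -/
noncomputable def run (σ : List ℕ) (i n : ℕ) : Option ℕ :=
  ((List.range (σ.length + 1)).filterMap fun s => runOnce (σ.take s) i n).head?

theorem primrec_runOnce : Primrec fun x : List ℕ × ℕ × ℕ => runOnce x.1 x.2.1 x.2.2 := by
  have hl : Primrec fun x : List ℕ × ℕ × ℕ => x.1.length.unpair :=
    Primrec.unpair.comp (Primrec.list_length.comp Primrec.fst)
  refine Nat.Partrec.Code.primrec_evaln.comp (Primrec.pair (Primrec.pair (Primrec.snd.comp hl)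
    ((Code.primrec_translate _).comp (Primrec.fst.comp Primrec.snd))) ?_)
  exact Primrec₂.natPair.comp (Primrec.encode.comp
    (Primrec.list_take.comp (Primrec.fst.comp hl) Primrec.fst)) (Primrec.snd.comp Primrec.snd)

theorem primrec_run : Primrec fun x : List ℕ × ℕ × ℕ => run x.1 x.2.1 x.2.2 := by
  refine Primrec.list_head?.comp (Primrec.listFilterMap (Primrec.list_range.comp
    (Primrec.succ.comp (Primrec.list_length.comp Primrec.fst))) ?_)
  exact primrec_runOnce.comp (Primrec.pair
    (Primrec.list_take.comp Primrec.snd (Primrec.fst.comp Primrec.fst))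
    (Primrec.snd.comp Primrec.fst))

/-- `run` takes the first success among the prefixes of its oracle. A longer oracle only appends
later attempts, so a result once found never changes, even if the longer oracle is not part of any
intended sequence. -/
theorem run_mono {σ τ : List ℕ} (h : σ <+: τ) {i n v : ℕ} (hv : run σ i n = some v) :
    run τ i n = some v := by
  have : ((List.range (σ.length + 1)).filterMap fun s => runOnce (σ.take s) i n) <+:
      (List.range (τ.length + 1)).filterMap fun s => runOnce (τ.take s) i n := by
    have h1 : ((List.range (σ.length + 1)).filterMap fun s => runOnce (σ.take s) i n) =
        (List.range (σ.length + 1)).filterMap fun s => runOnce (τ.take s) i n := by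
      refine List.filterMap_congr fun s hs => ?_
      obtain ⟨ρ, rfl⟩ := h
      rw [List.take_append_of_le_length (by rw [List.mem_range] at hs; omega)]
    rw [h1]
    refine List.IsPrefix.filterMap _ ?_
    have := h.length_le
    have h2 : List.range (σ.length + 1) = (List.range (τ.length + 1)).take (σ.length + 1) := by
      rw [List.take_range, min_eq_left (by omega)]
    rw [h2]
    exact List.take_prefix _ _
  obtain ⟨ρ, hρ⟩ := this
  unfold run at hv ⊢
  rw [← hρ, List.head?_append, hv]
  rfl

theorem eval_translate_lookupCode (σ : List ℕ) (c : Code) (n : ℕ) :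
    (Code.translate lookupCode c).eval (Nat.pair (Encodable.encode σ) n) =
      Code.evalWith (listOracle σ) c n :=
  Code.eval_translate (exists_lookupCode.choose_spec σ) c n

theorem mem_eval_of_runOnce {p : Baire} {s i n v : ℕ} (h : runOnce (pre p s) i n = some v) :
    v ∈ (Code.ofNatCode i).eval p n := by
  have := Nat.Partrec.Code.evaln_sound (show v ∈ _ from h)
  rw [take_pre, eval_translate_lookupCode] at this
  exact Code.mem_eval_of_listOracle this

theorem exists_runOnce {p : Baire} {i n v : ℕ} (h : v ∈ (Code.ofNatCode i).eval p n) :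
    ∃ s, runOnce (pre p s) i n = some v := by
  obtain ⟨s, hs⟩ := (Code.eventually_listOracle _ h).exists
  rw [← eval_translate_lookupCode,
    Nat.Partrec.Code.evaln_complete] at hs
  obtain ⟨k, hk⟩ := hs
  -- This length is decoded as `s` oracle values and `k` steps.
  refine ⟨Nat.pair s k, ?_⟩
  rw [runOnce, take_pre, pre_length, Nat.unpair_pair, min_eq_left (Nat.left_le_pair s k)]
  exact hk

/-- Some attempt is successful by the use principle; an earlier success may come first in `run`, but
it is sound and hence has the same value. -/
theorem mem_eval_iff_run {p : Baire} {i n v : ℕ} :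
    v ∈ (Code.ofNatCode i).eval p n ↔ ∃ s, run (pre p s) i n = some v := by
  have sound : ∀ {s v}, run (pre p s) i n = some v → v ∈ (Code.ofNatCode i).eval p n := by
    intro s v h
    have := List.mem_of_mem_head? (show v ∈ _ from h)
    rw [List.mem_filterMap] at this
    obtain ⟨t, -, ht⟩ := this
    rw [take_pre] at ht
    exact mem_eval_of_runOnce ht
  refine ⟨fun h => ?_, fun ⟨s, h⟩ => sound h⟩
  obtain ⟨s, hs⟩ := exists_runOnce h
  refine ⟨s, ?_⟩
  cases hr : run (pre p s) i n with
  | some w => rw [Part.mem_unique h (sound hr)]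
  | none =>
    rw [run, List.head?_eq_none_iff, List.filterMap_eq_nil_iff] at hr
    have := hr s (by simp)
    rw [take_pre, min_self, hs] at this
    cases this

theorem haltsOn_iff_run {p : Baire} {i : ℕ} :
    HaltsOn (Code.ofNatCode i) p ↔ ∃ s, (run (pre p s) i 0).isSome := by
  simp only [HaltsOn, Part.dom_iff_mem, mem_eval_iff_run, Option.isSome_iff_exists]
  exact exists_comm

/-! ### Construction of programs -/

namespace Code

theorem eval_comp_of_mem {p : Baire} {cf cg : Code} {n x : ℕ} (hx : x ∈ eval p cg n) :
    eval p (comp cf cg) n = eval p cf x := by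
  change (eval p cg n).bind (fun x => eval p cf x) = _
  rw [Part.eq_some_iff.2 hx, Part.bind_some]

theorem mem_eval_comp {p : Baire} {cf cg : Code} {n x v : ℕ} (hx : x ∈ eval p cg n)
    (hv : v ∈ eval p cf x) : v ∈ eval p (comp cf cg) n := by
  rwa [eval_comp_of_mem hx]

theorem mem_eval_pair {p : Baire} {cf cg : Code} {n x y : ℕ} (hx : x ∈ eval p cf n)
    (hy : y ∈ eval p cg n) : Nat.pair x y ∈ eval p (pair cf cg) n := by
  rw [eval_eq_evalWith] at *
  exact (mem_evalWith_pair _ _ _).2 ⟨x, hx, y, hy, rfl⟩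

theorem mem_eval_left (p : Baire) (a b : ℕ) : a ∈ eval p left (Nat.pair a b) := by
  simp [eval]

theorem mem_eval_right (p : Baire) (a b : ℕ) : b ∈ eval p right (Nat.pair a b) := by
  simp [eval]

theorem mem_eval_oracle (p : Baire) (n : ℕ) : p n ∈ eval p oracle n := by
  simp [eval]

theorem mem_eval_zero (p : Baire) (n : ℕ) : 0 ∈ eval p zero n := Part.mem_some 0

/-- The identity. -/
protected def id : Code := pair left right

theorem mem_eval_id (p : Baire) (n : ℕ) : n ∈ eval p Code.id n := by
  have h := mem_eval_pair (mem_eval_left p n.unpair.1 n.unpair.2)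
    (mem_eval_right p n.unpair.1 n.unpair.2)
  rwa [Nat.pair_unpair] at h

/-- The constant functions. -/
protected def const : ℕ → Code
  | 0 => zero
  | m + 1 => comp succ (Code.const m)

theorem mem_eval_const (p : Baire) (n : ℕ) : ∀ m, m ∈ eval p (Code.const m) n
  | 0 => mem_eval_zero p n
  | m + 1 => mem_eval_comp (mem_eval_const p n m) (by simp [eval])

theorem primrec_encodeCode_const : Primrec fun m => encodeCode (Code.const m) := by
  have h : Primrec fun x : ℕ × ℕ => 2 * (2 * Nat.pair 1 x.2 + 1) + 5 := by
    refine Primrec.nat_add.comp (Primrec.nat_mul.comp (Primrec.const 2) (Primrec.nat_add.comp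
      (Primrec.nat_mul.comp (Primrec.const 2) (Primrec₂.natPair.comp (Primrec.const 1) Primrec.snd))
      (Primrec.const 1))) (Primrec.const 5)
  refine (Primrec.nat_rec₁ 0 h.to₂).of_eq fun m => ?_
  induction m with
  | zero => rfl
  | succ m ih => simp only [ih]; rfl

theorem eval_comp_const (p : Baire) (c : Code) (m n : ℕ) :
    eval p (comp c (Code.const m)) n = eval p c m :=
  eval_comp_of_mem (mem_eval_const p n m)

/-- Partial recursive functions as programs that do not use the oracle. -/
def ofPartrec : Nat.Partrec.Code → Code
  | .zero => zero
  | .succ => succ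
  | .left => left
  | .right => right
  | .pair cf cg => pair (ofPartrec cf) (ofPartrec cg)
  | .comp cf cg => comp (ofPartrec cf) (ofPartrec cg)
  | .prec cf cg => prec (ofPartrec cf) (ofPartrec cg)
  | .rfind' cf => rfind' (ofPartrec cf)

theorem eval_ofPartrec (p : Baire) (c : Nat.Partrec.Code) : eval p (ofPartrec c) = c.eval := by
  induction c with
  | zero | succ | left | right => rfl
  | pair cf cg hf hg => rw [ofPartrec, eval, hf, hg]; rfl
  | comp cf cg hf hg => rw [ofPartrec, eval, hf, hg]; rfl
  | prec cf cg hf hg => rw [ofPartrec, eval, hf, hg]; rfl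
  | rfind' cf hf => rw [ofPartrec, eval, hf]; rfl

theorem exists_of_computable {α β : Type} [Primcodable α] [Primcodable β] {f : α → β}
    (hf : Computable f) : ∃ c : Code, ∀ p a,
      Encodable.encode (f a) ∈ eval p c (Encodable.encode a) := by
  obtain ⟨l, hl⟩ := Nat.Partrec.Code.exists_code.1 hf
  refine ⟨ofPartrec l, fun p a => ?_⟩
  rw [eval_ofPartrec, hl]
  simp

theorem exists_iterate (c : Code) (x₀ : ℕ) : ∃ d : Code, ∀ (p : Baire) (x : ℕ → ℕ), x 0 = x₀ →
    (∀ i, x (i + 1) ∈ eval p c (Nat.pair i (x i))) → ∀ n, x n ∈ eval p d n := by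
  -- `prec` requires a parameter: a dummy `0` is supplied and then stripped by `right`.
  refine ⟨comp (prec (Code.const x₀) (comp c right)) (pair zero Code.id), ?_⟩
  intro p x h0 hs n
  refine mem_eval_comp (mem_eval_pair (mem_eval_zero p n) (mem_eval_id p n)) ?_
  rw [eval_eq_evalWith, evalWith_prec, Nat.unpair_pair, ← eval_eq_evalWith, ← eval_eq_evalWith]
  induction n with
  | zero => rw [h0]; exact mem_eval_const p _ _
  | succ n ih => exact Part.mem_bind_iff.2 ⟨_, ih, mem_eval_comp (mem_eval_right _ _ _) (hs n)⟩

theorem exists_pre (c : Code) : ∃ d : Code, ∀ (p a : Baire), (∀ s, a s ∈ eval p c s) →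
    ∀ n, Encodable.encode (pre a n) ∈ eval p d n := by
  obtain ⟨e, he⟩ := exists_of_computable (f := fun x : ℕ × List ℕ => x.2 ++ [x.1])
    (Primrec.list_concat.comp Primrec.snd Primrec.fst).to_comp
  obtain ⟨d, hd⟩ := exists_iterate (comp e (pair (comp c left) right))
    (Encodable.encode ([] : List ℕ))
  refine ⟨d, fun p a ha n => hd p (fun n => Encodable.encode (pre a n)) rfl (fun i => ?_) n⟩
  refine mem_eval_comp (mem_eval_pair (mem_eval_comp (mem_eval_left _ _ _) (ha i))
    (mem_eval_right _ _ _)) ?_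
  rw [pre_succ]
  exact he p (a i, pre a i)

/-- Minimise over the length of the oracle prefix. This is the general search tool: the length `s`
can also encode the candidate being tested, as in later applications. -/
theorem exists_search {g : List ℕ → ℕ → Option ℕ} (hg : Computable₂ g) :
    ∃ c : Code, ∀ p n, (∀ v ∈ eval p c n, ∃ s, g (pre p s) n = some v) ∧
      ((∃ s, (g (pre p s) n).isSome) → (eval p c n).Dom) := by
  have hg' : Computable fun x : ℕ × List ℕ => g x.2 x.1 := hg.comp Computable.snd Computable.fst
  obtain ⟨t, ht⟩ := exists_pre oracle
  replace ht := fun p => ht p p (mem_eval_oracle p)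
  obtain ⟨e₁, he₁⟩ := exists_of_computable
    (f := fun x : ℕ × List ℕ => bif (g x.2 x.1).isSome then 0 else 1)
    (Computable.cond (Primrec.option_isSome.to_comp.comp hg') (Computable.const 0)
      (Computable.const 1))
  obtain ⟨e₂, he₂⟩ := exists_of_computable (f := fun x : ℕ × List ℕ => (g x.2 x.1).getD 0)
    (Computable.option_getD hg' (Computable.const 0))
  let h : Code := comp e₁ (pair left (comp t right))
  have hh : ∀ p n k, (bif (g (pre p k) n).isSome then 0 else 1) ∈ eval p h (Nat.pair n k) :=
    fun p n k => mem_eval_comp (mem_eval_pair (mem_eval_left _ _ _)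
      (mem_eval_comp (mem_eval_right _ _ _) (ht p k))) (he₁ p (n, pre p k))
  let r : Code := comp (rfind' h) (pair Code.id zero)
  have hr : ∀ p n k, k ∈ eval p r n ↔
      (g (pre p k) n).isSome ∧ ∀ m < k, ¬ (g (pre p m) n).isSome := by
    intro p n k
    have h1 : eval p r n = eval p (rfind' h) (Nat.pair n 0) :=
      eval_comp_of_mem (mem_eval_pair (mem_eval_id p n) (mem_eval_zero p n))
    have h2 : ∀ k, evalWith (p : ℕ →. ℕ) h (Nat.pair n k) =
        Part.some (bif (g (pre p k) n).isSome then 0 else 1) := fun k => by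
      rw [← eval_eq_evalWith, Part.eq_some_iff]; exact hh p n k
    rw [h1, eval_eq_evalWith, mem_evalWith_rfind']
    simp only [Nat.unpair_pair, Nat.add_zero, h2, Part.mem_some_iff, exists_eq_left]
    constructor
    · rintro ⟨k, h0, hm, rfl⟩
      refine ⟨?_, fun m hmk hs => hm m hmk ?_⟩
      · cases hs : (g (pre p k) n).isSome
        · rw [hs] at h0; exact absurd h0 (by decide)
        · rfl
      · simp [hs]
    · rintro ⟨h0, hm⟩
      exact ⟨k, by simp [h0], fun m hmk => by simp [hm m hmk], rfl⟩
  refine ⟨comp e₂ (pair Code.id (comp t r)), fun p n => ?_⟩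
  have hc : ∀ k ∈ eval p r n, (g (pre p k) n).getD 0 ∈
      eval p (comp e₂ (pair Code.id (comp t r))) n := fun k hk =>
    mem_eval_comp (mem_eval_pair (mem_eval_id p n) (mem_eval_comp hk (ht p k)))
      (he₂ p (n, pre p k))
  constructor
  · intro v hv
    have hd : (eval p r n).Dom := by
      rw [eval_eq_evalWith, mem_evalWith_comp] at hv
      obtain ⟨x, hx, -⟩ := hv
      rw [mem_evalWith_pair] at hx
      obtain ⟨-, -, y, hy, -⟩ := hx
      rw [mem_evalWith_comp] at hy
      obtain ⟨z, hz, -⟩ := hy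
      rw [eval_eq_evalWith]
      exact Part.dom_iff_mem.2 ⟨z, hz⟩
    obtain ⟨k, hk⟩ := Part.dom_iff_mem.1 hd
    obtain ⟨w, hw⟩ := Option.isSome_iff_exists.1 ((hr p n k).1 hk).1
    refine ⟨k, ?_⟩
    have := hc k hk
    rw [hw] at this ⊢
    rw [Part.mem_unique hv this]
    rfl
  · intro hs
    have hk : Nat.find hs ∈ eval p r n :=
      (hr p n _).2 ⟨Nat.find_spec hs, fun m hm => Nat.find_min hs hm⟩
    exact Part.dom_iff_mem.2 ⟨_, hc _ hk⟩

end Code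

/-! ### The Turing jump -/

open Classical in
theorem jump_apply (q : Baire) (i : ℕ) :
    jump q i = if HaltsOn (Code.ofNatCode i) q then 1 else 0 := rfl

theorem jump_eq_one_iff {q : Baire} {i : ℕ} : jump q i = 1 ↔ HaltsOn (Code.ofNatCode i) q := by
  rw [jump_apply]; split_ifs with h <;> simp [h]

theorem jump_eq_zero_iff {q : Baire} {i : ℕ} : jump q i = 0 ↔ ¬ HaltsOn (Code.ofNatCode i) q := by
  rw [jump_apply]; split_ifs with h <;> simp [h]

/-- The s-m-n argument: hard-wiring `m` into a search program is computable in `m`, so the jump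
answers semidecidable questions about `q` uniformly. -/
theorem exists_index {g : List ℕ → ℕ → Bool} (hg : Computable₂ g) : ∃ f : ℕ → ℕ, Computable f ∧
    ∀ q m, (jump q (f m) = 1 ↔ ∃ s, g (pre q s) m = true) ∧
      (jump q (f m) = 0 ↔ ∀ s, g (pre q s) m = false) := by
  obtain ⟨c, hc⟩ := Code.exists_search (g := fun σ m => bif g σ m then some 0 else none)
    (Computable.cond hg (Computable.const _) (Computable.const _))
  refine ⟨fun m => Code.encodeCode (.comp c (Code.const m)), ?_, fun q m => ?_⟩
  · refine Primrec.to_comp ?_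
    exact Primrec.nat_add.comp (Primrec.nat_mul.comp (Primrec.const 2) (Primrec.nat_add.comp
      (Primrec.nat_mul.comp (Primrec.const 2) (Primrec₂.natPair.comp (Primrec.const _)
        Code.primrec_encodeCode_const)) (Primrec.const 1))) (Primrec.const 5)
  · have : HaltsOn (Code.ofNatCode (Code.encodeCode (.comp c (Code.const m)))) q ↔
        ∃ s, g (pre q s) m = true := by
      rw [Code.ofNatCode_encodeCode, HaltsOn, Code.eval_comp_const]
      constructor
      · intro h
        obtain ⟨s, hs⟩ := (hc q m).1 _ (Part.get_mem h)
        refine ⟨s, ?_⟩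
        cases hgs : g (pre q s) m <;> simp [hgs] at hs ⊢
      · rintro ⟨s, hs⟩
        exact (hc q m).2 ⟨s, by simp [hs]⟩
    rw [jump_eq_one_iff, jump_eq_zero_iff, this]
    simp

/-! ### Output tapes -/

theorem tapeContent_succ_of_eq {a : ℕ → ℕ} {n t v : ℕ} (h : a t = Nat.pair n v + 1) :
    tapeContent a n (t + 1) = some v := by
  simp [tapeContent, h]

theorem tapeContent_succ_of_ne {a : ℕ → ℕ} {n t : ℕ} (h : ∀ v, a t ≠ Nat.pair n v + 1) :
    tapeContent a n (t + 1) = tapeContent a n t := by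
  rw [tapeContent]
  split
  · rfl
  · next k hk =>
    rw [if_neg]
    rintro rfl
    exact h k.unpair.2 (by rw [hk, Nat.pair_unpair])

theorem exists_last_write {a : ℕ → ℕ} {n v t : ℕ} (h : tapeContent a n t = some v) :
    ∃ s < t, a s = Nat.pair n v + 1 ∧ ∀ u, s < u → u < t → ∀ w, a u ≠ Nat.pair n w + 1 := by
  induction t with
  | zero => cases h
  | succ t ih =>
    by_cases hw : ∃ w, a t = Nat.pair n w + 1
    · obtain ⟨w, hw⟩ := hw
      rw [tapeContent_succ_of_eq hw, Option.some_inj] at h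
      subst h
      exact ⟨t, t.lt_succ_self, hw, fun u h1 h2 => by omega⟩
    · push Not at hw
      rw [tapeContent_succ_of_ne hw] at h
      obtain ⟨s, hs, has, hu⟩ := ih h
      refine ⟨s, by omega, has, fun u h1 h2 => ?_⟩
      obtain rfl | h3 := eq_or_lt_of_le (Nat.lt_succ_iff.1 h2)
      · exact hw
      · exact hu u h1 h3

/-- Only writes matter. This replaces the limit of the tape by one write and the absence of a later
conflicting write, conditions on single actions that the jump can decide. -/
theorem tapeContent_stabilizes_iff {a : ℕ → ℕ} {n v : ℕ} :
    (∃ T, ∀ t, T ≤ t → tapeContent a n t = some v) ↔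
      ∃ s, a s = Nat.pair n v + 1 ∧ ∀ t, s < t → ∀ w, a t = Nat.pair n w + 1 → w = v := by
  constructor
  · rintro ⟨T, hT⟩
    obtain ⟨s, hs, has, hu⟩ := exists_last_write (hT T le_rfl)
    refine ⟨s, has, fun t hst w hw => ?_⟩
    rcases lt_or_ge t T with h | h
    · exact absurd hw (hu t hst h w)
    · have := hT (t + 1) (by omega)
      rwa [tapeContent_succ_of_eq hw, Option.some_inj] at this
  · rintro ⟨s, has, h⟩
    refine ⟨s + 1, fun t hst => ?_⟩
    induction t, hst using Nat.le_induction with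
    | base => exact tapeContent_succ_of_eq has
    | succ t hst ih =>
      by_cases hw : ∃ w, a t = Nat.pair n w + 1
      · obtain ⟨w, hw⟩ := hw
        rw [tapeContent_succ_of_eq hw, h t (by omega) w hw]
      · push Not at hw
        rw [tapeContent_succ_of_ne hw, ih]

theorem isLimitComputable_iff {F : Baire →. Baire} : IsLimitComputable F ↔
    ∃ c : Code, ∀ p, ∀ x ∈ F p, ∃ a : ℕ → ℕ, (∀ s, a s ∈ c.eval p s) ∧
      ∀ n, ∃ s, a s = Nat.pair n (x n) + 1 ∧
        ∀ t, s < t → ∀ w, a t = Nat.pair n w + 1 → w = x n := by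
  simp only [IsLimitComputable, tapeContent_stabilizes_iff]
  refine exists_congr fun c => forall_congr' fun p => ?_
  constructor
  · rintro h _ ⟨hd, rfl⟩
    exact h hd
  · exact fun h hd => h _ ⟨hd, rfl⟩

/-- The content of cell `n` after the output actions in a list. -/
def tapeList (l : List ℕ) (n : ℕ) : Option ℕ :=
  l.foldl (fun o k => Nat.casesOn k o fun k => if k.unpair.1 = n then some k.unpair.2 else o) none

theorem tapeList_pre (a : ℕ → ℕ) (n t : ℕ) : tapeList (pre a t) n = tapeContent a n t := by
  induction t with
  | zero => rfl
  | succ t ih =>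
    rw [tapeList, pre_succ, List.foldl_append]
    change List.foldl _ (tapeList (pre a t) n) _ = _
    rw [ih, List.foldl_cons, List.foldl_nil, tapeContent]
    cases a t <;> rfl

theorem primrec_tapeList : Primrec₂ tapeList := by
  have hk : Primrec fun x : ((List ℕ × ℕ) × Option ℕ × ℕ) × ℕ => x.2.unpair :=
    Primrec.unpair.comp Primrec.snd
  have h : Primrec₂ fun (x : List ℕ × ℕ) (y : Option ℕ × ℕ) => (Nat.casesOn y.2 y.1 fun k =>
      if k.unpair.1 = x.2 then some k.unpair.2 else y.1 : Option ℕ) :=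
    Primrec.nat_casesOn (Primrec.snd.comp Primrec.snd) (Primrec.fst.comp Primrec.snd)
      (Primrec.ite (Primrec.eq.comp (Primrec.fst.comp hk)
          (Primrec.snd.comp (Primrec.fst.comp Primrec.fst)))
        (Primrec.option_some.comp (Primrec.snd.comp hk))
        (Primrec.fst.comp (Primrec.snd.comp Primrec.fst)))
  exact Primrec.list_foldl Primrec.fst (Primrec.const none) h

/-! ### The limit map -/

theorem mem_limMap {q p : Baire} : p ∈ limMap q ↔ Tendsto (row q) atTop (𝓝 p) := by
  constructor
  · rintro ⟨h, rfl⟩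
    exact h.choose_spec
  · intro h
    have h' : ∃ p, Tendsto (row q) atTop (𝓝 p) := ⟨p, h⟩
    exact ⟨h', tendsto_nhds_unique h'.choose_spec h⟩

theorem mem_limMap_iff_eventually {q p : Baire} :
    p ∈ limMap q ↔ ∀ k, ∀ᶠ i in atTop, q (cantorPair i k) = p k := by
  simp only [mem_limMap, tendsto_pi_nhds, nhds_discrete, tendsto_pure, row]

theorem primrec_cantorPair : Primrec₂ cantorPair := by
  have h : Primrec₂ fun n k : ℕ => n + k := Primrec.nat_add
  exact Primrec.nat_add.comp (Primrec.nat_div.comp (Primrec.nat_mul.comp h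
    (Primrec.nat_add.comp h (Primrec.const 1))) (Primrec.const 2)) Primrec.snd

/-- In step `Nat.pair k i` the machine copies entry `k` of row `i` into cell `k`. Since `Nat.pair k`
is increasing, cell `k` sees the rows in their order. -/
theorem isLimitComputable_limMap : IsLimitComputable limMap := by
  obtain ⟨e, he⟩ := Code.exists_of_computable
    (f := fun s : ℕ => cantorPair s.unpair.2 s.unpair.1) (primrec_cantorPair.comp
      (Primrec.snd.comp Primrec.unpair) (Primrec.fst.comp Primrec.unpair)).to_comp
  rw [isLimitComputable_iff]
  refine ⟨.comp .succ (.pair .left (.comp .oracle e)), fun q p hp =>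
    ⟨fun s => Nat.pair s.unpair.1 (q (cantorPair s.unpair.2 s.unpair.1)) + 1, fun s => ?_,
      fun k => ?_⟩⟩
  · refine Code.mem_eval_comp (Code.mem_eval_pair (x := s.unpair.1) ?_ (Code.mem_eval_comp (he q s)
      (Code.mem_eval_oracle _ _))) (by simp [Code.eval])
    simp [Code.eval]
  · obtain ⟨i, hi⟩ := eventually_atTop.1 (mem_limMap_iff_eventually.1 hp k)
    refine ⟨Nat.pair k i, by simp [hi i le_rfl], fun t ht w hw => ?_⟩
    rw [Nat.add_right_cancel_iff, Nat.pair_eq_pair] at hw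
    obtain ⟨rfl, rfl⟩ := hw
    refine hi _ (not_lt.1 fun h => ?_)
    have := Nat.pair_lt_pair_right t.unpair.1 h
    rw [Nat.pair_unpair] at this
    omega

theorem isLimitComputable_id : IsLimitComputable (PFun.id Baire) := by
  rw [isLimitComputable_iff]
  refine ⟨.comp .succ (.pair Code.id .oracle), fun p x hx => ⟨fun s => Nat.pair s (p s) + 1,
    fun s => ?_, fun n => ⟨n, ?_, fun t ht w hw => ?_⟩⟩⟩
  · exact Code.mem_eval_comp (Code.mem_eval_pair (Code.mem_eval_id _ _)
      (Code.mem_eval_oracle _ _)) (by simp [Code.eval])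
  · rw [Part.mem_some_iff.1 hx]
  · rw [Nat.add_right_cancel_iff, Nat.pair_eq_pair] at hw
    omega

/-! ### Limits and the jump -/

/-- Limit computable functions are computable in the jump of the input. -/
theorem IsLimitComputable.exists_code_jump {K : Baire →. Baire} (hK : IsLimitComputable K) :
    ∃ d : Code, ∀ q, ∀ x ∈ K q, ∀ n, x n ∈ d.eval (jump q) n := by
  obtain ⟨c, hc⟩ := isLimitComputable_iff.1 hK
  have c_eq : Code.ofNatCode (Code.encodeCode c) = c := Code.ofNatCode_encodeCode c
  generalize Code.encodeCode c = i at c_eq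
  have hm1 : Primrec fun x : List ℕ × ℕ => x.2.unpair.1 :=
    Primrec.fst.comp (Primrec.unpair.comp Primrec.snd)
  have hm2 : Primrec fun x : List ℕ × ℕ => x.2.unpair.2.unpair :=
    Primrec.unpair.comp (Primrec.snd.comp (Primrec.unpair.comp Primrec.snd))
  -- For `m` coding `(n, s, v)`, `α m` indexes the question whether step `s` writes `v` into cell
  -- `n`.
  obtain ⟨α, hα, α_spec⟩ := exists_index (g := fun σ m =>
      decide (run σ i m.unpair.2.unpair.1 = some (Nat.pair m.unpair.1 m.unpair.2.unpair.2 + 1)))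
    (Primrec.to_comp (PrimrecPred.decide (Primrec.eq.comp (primrec_run.comp (Primrec.pair
        Primrec.fst (Primrec.pair (Primrec.const i) (Primrec.fst.comp hm2))))
      (Primrec.option_some.comp (Primrec.succ.comp
        (Primrec₂.natPair.comp hm1 (Primrec.snd.comp hm2)))))))
  -- `β m` indexes the question whether some step `t > s` writes a value other than `v` into cell
  -- `n`. The length of `σ` encodes `t` besides bounding the run; the default `0` counts an
  -- unfinished run as no write.
  obtain ⟨β, hβ, β_spec⟩ := exists_index (g := fun σ m =>
      decide (m.unpair.2.unpair.1 < σ.length.unpair.1 ∧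
        ((run σ i σ.length.unpair.1).getD 0 ≠ 0 ∧
        ((run σ i σ.length.unpair.1).getD 0 - 1).unpair.1 = m.unpair.1 ∧
        ((run σ i σ.length.unpair.1).getD 0 - 1).unpair.2 ≠ m.unpair.2.unpair.2))) (by
    have hl : Primrec fun x : List ℕ × ℕ => x.1.length.unpair.1 :=
      Primrec.fst.comp (Primrec.unpair.comp (Primrec.list_length.comp Primrec.fst))
    have hr : Primrec fun x : List ℕ × ℕ => (run x.1 i x.1.length.unpair.1).getD 0 :=
      Primrec.option_getD.comp (primrec_run.comp (Primrec.pair Primrec.fst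
        (Primrec.pair (Primrec.const i) hl))) (Primrec.const 0)
    have hr' : Primrec fun x : List ℕ × ℕ => ((run x.1 i x.1.length.unpair.1).getD 0 - 1).unpair :=
      Primrec.unpair.comp (Primrec.nat_sub.comp hr (Primrec.const 1))
    exact (PrimrecPred.decide ((Primrec.nat_lt.comp (Primrec.fst.comp hm2) hl).and
      ((Primrec.eq.comp hr (Primrec.const 0)).not.and
      ((Primrec.eq.comp (Primrec.fst.comp hr') hm1).and
      (Primrec.eq.comp (Primrec.snd.comp hr') (Primrec.snd.comp hm2)).not)))).to_comp)
  -- Here `σ` is a prefix of the jump, whose length encodes a candidate step, a candidate value and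
  -- padding.
  let arg (σ : List ℕ) (n : ℕ) : ℕ :=
    Nat.pair n (Nat.pair σ.length.unpair.1 σ.length.unpair.2.unpair.1)
  have harg : Computable₂ arg := by
    have hl : Primrec fun x : List ℕ × ℕ => x.1.length.unpair :=
      Primrec.unpair.comp (Primrec.list_length.comp Primrec.fst)
    exact (Primrec₂.natPair.comp Primrec.snd (Primrec₂.natPair.comp (Primrec.fst.comp hl)
      (Primrec.fst.comp (Primrec.unpair.comp (Primrec.snd.comp hl))))).to_comp
  obtain ⟨d, hd⟩ := Code.exists_search (g := fun σ n =>
      bif decide (σ[α (arg σ n)]? = some 1) && decide (σ[β (arg σ n)]? = some 0)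
        then some σ.length.unpair.2.unpair.1 else none) (by
    have h1 : ∀ {f : ℕ → ℕ}, Computable f → ∀ k, Computable fun x : List ℕ × ℕ =>
        decide (x.1[f (arg x.1 x.2)]? = some k) := fun hf k =>
      (Primrec.eq (α := Option ℕ)).decide.to_comp.comp
        (Primrec.list_getElem?.to_comp.comp Computable.fst (hf.comp harg)) (Computable.const _)
    exact Computable.cond (Primrec.and.to_comp.comp (h1 hα 1) (h1 hβ 0))
      (Primrec.option_some.comp (Primrec.fst.comp (Primrec.unpair.comp (Primrec.snd.comp
        (Primrec.unpair.comp (Primrec.list_length.comp Primrec.fst)))))).to_comp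
      (Computable.const none))
  refine ⟨d, fun q x hx n => ?_⟩
  obtain ⟨a, ha, hax⟩ := hc q x hx
  obtain ⟨s₀, hs₀, hlast⟩ := hax n
  have α_iff : ∀ n s v, jump q (α (Nat.pair n (Nat.pair s v))) = 1 ↔ a s = Nat.pair n v + 1 := by
    intro n s v
    simp only [(α_spec q _).1, Nat.unpair_pair, decide_eq_true_eq]
    rw [← mem_eval_iff_run, c_eq]
    exact ⟨fun h => Part.mem_unique (ha s) h, fun h => h ▸ ha s⟩
  have β_iff : ∀ n s v, jump q (β (Nat.pair n (Nat.pair s v))) = 0 ↔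
      ∀ t, s < t → ∀ w, a t = Nat.pair n w + 1 → w = v := by
    intro n s v
    simp only [(β_spec q _).2, Nat.unpair_pair, pre_length, decide_eq_false_iff_not]
    constructor
    · intro h t hst w hw
      by_contra hwv
      have := ha t
      rw [← c_eq, mem_eval_iff_run] at this
      obtain ⟨u, hu⟩ := this
      refine h (Nat.pair t u) ?_
      rw [Nat.unpair_pair, run_mono (pre_prefix q (Nat.right_le_pair t u)) hu]
      simp [hst, hw, hwv]
    · rintro h u ⟨hst, h0, h1, h2⟩
      cases hr : run (pre q u) i u.unpair.1 with
      | none => simp [hr] at h0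
      | some k =>
        rw [hr, Option.getD_some] at h0 h1 h2
        have hk : a u.unpair.1 = k :=
          Part.mem_unique (ha _) (c_eq ▸ mem_eval_iff_run.2 ⟨u, hr⟩)
        obtain ⟨k, rfl⟩ := Nat.exists_eq_succ_of_ne_zero h0
        refine h2 (h _ hst _ ?_)
        rw [hk, ← h1]
        simp
  have hdom : (d.eval (jump q) n).Dom := by
    set m := Nat.pair n (Nat.pair s₀ (x n)) with hm
    -- Padding that makes the prefix of the jump long enough to contain both queried positions.
    set k := α m + β m + 1 with hk
    have hle : k ≤ Nat.pair s₀ (Nat.pair (x n) k) :=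
      (Nat.right_le_pair _ _).trans (Nat.right_le_pair _ _)
    refine (hd _ n).2 ⟨Nat.pair s₀ (Nat.pair (x n) k), ?_⟩
    simp only [arg, pre_length, Nat.unpair_pair, ← hm]
    rw [pre_getElem? _ (by omega), pre_getElem? _ (by omega), (α_iff n s₀ (x n)).2 hs₀,
      (β_iff n s₀ (x n)).2 hlast]
    rfl
  obtain ⟨v, hv⟩ := Part.dom_iff_mem.1 hdom
  obtain ⟨u, hu⟩ := (hd _ n).1 v hv
  have : v = x n := by
    simp only [arg, pre_length] at hu
    generalize u.unpair.1 = s at hu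
    generalize u.unpair.2.unpair.1 = w at hu
    by_cases h : (pre (jump q) u)[α (Nat.pair n (Nat.pair s w))]? = some 1 ∧
      (pre (jump q) u)[β (Nat.pair n (Nat.pair s w))]? = some 0
    · have h1 := (α_iff n s w).1 (eq_of_pre_getElem? h.1)
      have h2 := (β_iff n s w).1 (eq_of_pre_getElem? h.2)
      rw [h.1, h.2] at hu
      obtain rfl : w = v := by simpa using hu
      -- Two writes, neither followed by a conflicting one, carry the same value: the later one must
      -- agree with the earlier.
      rcases lt_trichotomy s s₀ with h3 | h3 | h3
      · exact (h2 _ h3 _ hs₀).symm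
      · subst h3
        rw [hs₀, Nat.add_right_cancel_iff, Nat.pair_eq_pair] at h1
        exact h1.2.symm
      · exact hlast _ h3 _ h1
    · rw [← Bool.decide_and, decide_eq_false h] at hu
      cases hu
  exact this ▸ hv

/-- The identity is limit computable, so one program recovers every `q` from `J q`. -/
theorem jump_injective : Function.Injective jump := by
  obtain ⟨d, hd⟩ := isLimitComputable_id.exists_code_jump
  intro q q' h
  funext n
  refine Part.mem_unique (hd q q (Part.mem_some q) n) ?_
  rw [h]
  exact hd q' q' (Part.mem_some q') n

/-! ### Limit computations with the halting problem as an oracle -/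

theorem isComputableRelativeTo_iff {r : Baire} {F : Baire →. Baire} :
    IsComputableRelativeTo r F ↔
      ∃ d : Code, ∀ p, ∀ x ∈ F p, ∀ n, x n ∈ d.eval (join r p) n := by
  constructor
  · rintro ⟨G, ⟨c, hc⟩, hG⟩
    refine ⟨c, ?_⟩
    rintro p _ ⟨h, rfl⟩ n
    obtain ⟨hd, he⟩ := hG p h
    rw [← he]
    exact hc _ hd n
  · rintro ⟨d, hd⟩
    let odd (y : Baire) : Baire := fun n => y (2 * n + 1)
    have hodd : ∀ p, odd (join r p) = p := fun p => by
      funext n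
      have h1 : (2 * n + 1) % 2 = 1 := by omega
      have h2 : (2 * n + 1) / 2 = n := by omega
      simp [odd, join, h1, h2]
    -- The domain is cut down to the joins `⟨r, p⟩` with `p ∈ dom F`, where the program is known to
    -- be correct.
    refine ⟨fun y => ⟨y = join r (odd y) ∧ (F (odd y)).Dom, fun h => (F (odd y)).get h.2⟩,
      ⟨d, ?_⟩, fun p h => ?_⟩
    · rintro y ⟨hy, h⟩ n
      have := hd _ _ (Part.get_mem h) n
      rw [← hy] at this
      exact this
    · refine ⟨⟨by rw [hodd], by rw [hodd]; exact h⟩, ?_⟩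
      simp only [hodd]

theorem pre_prefix_of_getElem? {y : Baire} {M : ℕ} {l : List ℕ}
    (h : ∀ m < M, l[m]? = some (y m)) : pre y M <+: l := by
  rw [List.prefix_iff_getElem?]
  intro m hm
  have hm' : m < M := by simpa using hm
  rw [h m hm', ← pre_getElem? y hm', List.getElem?_eq_getElem]

/-- The approximation to `⟨0', x⟩` that is obtained from a list of output actions that
produce `x`. -/
noncomputable def approxOracle (l : List ℕ) : List ℕ :=
  (List.range l.length).map fun m =>
    if m % 2 = 0 then
      bif (run (pre (fun _ => 0) l.length) (m / 2) 0).isSome then 1 else 0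
    else (tapeList l (m / 2)).getD 0

theorem primrec_approxOracle : Primrec approxOracle := by
  refine Primrec.list_map (Primrec.list_range.comp Primrec.list_length) ?_
  have hm : Primrec fun x : List ℕ × ℕ => x.2 / 2 :=
    Primrec.nat_div.comp Primrec.snd (Primrec.const 2)
  refine Primrec.ite (Primrec.eq.comp (Primrec.nat_mod.comp Primrec.snd (Primrec.const 2))
    (Primrec.const 0)) (Primrec.cond (Primrec.option_isSome.comp (primrec_run.comp (Primrec.pair ?_
      (Primrec.pair hm (Primrec.const 0))))) (Primrec.const 1) (Primrec.const 0)) ?_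
  · exact Primrec.list_map (Primrec.list_range.comp (Primrec.list_length.comp Primrec.fst))
      (Primrec.const 0).to₂
  · exact Primrec.option_getD.comp (primrec_tapeList.comp Primrec.fst hm) (Primrec.const 0)

/-- Even entries increase to the halting bits, odd entries follow cells that stabilise, and a prefix
involves only finitely many entries. -/
theorem eventually_approxOracle {a x : Baire}
    (h : ∀ n, ∃ T, ∀ t, T ≤ t → tapeContent a n t = some (x n)) (M : ℕ) :
    ∀ᶠ t in atTop, pre (join haltingProblem x) M <+: approxOracle (pre a t) := by
  have key : ∀ m, ∀ᶠ t in atTop,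
      (approxOracle (pre a t))[m]? = some (join haltingProblem x m) := by
    intro m
    have hget : ∀ {t}, m < t → (approxOracle (pre a t))[m]? = some (if m % 2 = 0 then
        bif (run (pre (fun _ => 0) t) (m / 2) 0).isSome then 1 else 0
        else (tapeList (pre a t) (m / 2)).getD 0) := by
      intro t ht
      simp [approxOracle, ht]
    by_cases hm : m % 2 = 0
    · simp only [join, hm, if_true] at hget ⊢
      by_cases hh : HaltsOn (Code.ofNatCode (m / 2)) fun _ => 0
      · obtain ⟨s, hs⟩ := haltsOn_iff_run.1 hh
        filter_upwards [eventually_gt_atTop m, eventually_ge_atTop s] with t ht hst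
        obtain ⟨v, hv⟩ := Option.isSome_iff_exists.1 hs
        rw [hget ht, run_mono (pre_prefix _ hst) hv, haltingProblem, jump_eq_one_iff.2 hh]
        rfl
      · filter_upwards [eventually_gt_atTop m] with t ht
        rw [hget ht, haltingProblem, jump_eq_zero_iff.2 hh]
        rw [haltsOn_iff_run] at hh
        push Not at hh
        simp [hh t]
    · simp only [join, hm, if_false] at hget ⊢
      obtain ⟨T, hT⟩ := h (m / 2)
      filter_upwards [eventually_gt_atTop m, eventually_ge_atTop T] with t ht hTt
      rw [hget ht, tapeList_pre, hT t hTt]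
      rfl
  have := (Filter.eventually_all_finite (Set.finite_Iio M)).2 fun m _ => key m
  filter_upwards [this] with t ht
  exact pre_prefix_of_getElem? ht

theorem IsComputableRelativeTo.comp_isLimitComputable {F K : Baire →. Baire}
    (hF : IsComputableRelativeTo haltingProblem F) (hK : IsLimitComputable K) :
    IsLimitComputable (F.comp K) := by
  obtain ⟨d, hd⟩ := isComputableRelativeTo_iff.1 hF
  obtain ⟨c, hc⟩ := isLimitComputable_iff.1 hK
  obtain ⟨cp, hcp⟩ := Code.exists_pre c
  have d_eq : Code.ofNatCode (Code.encodeCode d) = d := Code.ofNatCode_encodeCode d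
  generalize Code.encodeCode d = j at d_eq
  obtain ⟨e, he⟩ := Code.exists_of_computable (f := fun x : ℕ × List ℕ =>
      ((run (approxOracle x.2) j x.1).map fun v => Nat.pair x.1 v + 1).getD 0)
    (Primrec.option_getD.comp (Primrec.option_map (primrec_run.comp (Primrec.pair
        (primrec_approxOracle.comp Primrec.snd) (Primrec.pair (Primrec.const j) Primrec.fst)))
      (Primrec.succ.comp (Primrec₂.natPair.comp (Primrec.fst.comp Primrec.fst)
        Primrec.snd)).to₂) (Primrec.const 0)).to_comp
  rw [isLimitComputable_iff]
  refine ⟨.comp e (.pair .left (.comp cp .right)), fun p y hy => ?_⟩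
  obtain ⟨x, hx, hyx⟩ : ∃ x ∈ K p, y ∈ F x := Part.mem_bind_iff.1 hy
  obtain ⟨a, ha, hax⟩ := hc p x hx
  -- Step `Nat.pair n t` runs the program for cell `n` on the approximation at time `t`. The run is
  -- bounded, so wrong approximations cannot block the machine; without a result it performs action
  -- `0`.
  refine ⟨fun s => ((run (approxOracle (pre a s.unpair.2)) j s.unpair.1).map
    fun v => Nat.pair s.unpair.1 v + 1).getD 0, fun s => ?_, fun n => ?_⟩
  · refine Code.mem_eval_comp ?_ (he p (s.unpair.1, pre a s.unpair.2))
    refine Code.mem_eval_pair ?_ (Code.mem_eval_comp ?_ (hcp p a ha s.unpair.2)) <;>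
      simp [Code.eval]
  · have hn := hd x y hyx n
    rw [← d_eq, mem_eval_iff_run] at hn
    obtain ⟨M, hM⟩ := hn
    obtain ⟨T, hT⟩ := eventually_atTop.1
      (eventually_approxOracle (fun n => tapeContent_stabilizes_iff.2 (hax n)) M)
    have hrun : ∀ t, T ≤ t → run (approxOracle (pre a t)) j n = some (y n) :=
      fun t ht => run_mono (hT t ht) hM
    refine ⟨Nat.pair n T, by simp [hrun T le_rfl], fun s hs w hw => ?_⟩
    cases hr : run (approxOracle (pre a s.unpair.2)) j s.unpair.1 with
    | none => simp [hr] at hw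
    | some v =>
      simp only [hr, Option.map_some, Option.getD_some] at hw
      rw [Nat.add_right_cancel_iff, Nat.pair_eq_pair] at hw
      obtain ⟨rfl, rfl⟩ := hw
      rw [hrun] at hr
      · exact (Option.some_inj.1 hr).symm
      · refine not_lt.1 fun h => ?_
        have := Nat.pair_lt_pair_right s.unpair.1 h
        rw [Nat.pair_unpair] at this
        omega

/-! ### Inverse of the Cantor pairing -/

/-- The inverse of the Cantor pairing. -/
def cantorUnpair : ℕ → ℕ × ℕ
  | 0 => (0, 0)
  | m + 1 => if (cantorUnpair m).1 = 0 then ((cantorUnpair m).2 + 1, 0)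
      else ((cantorUnpair m).1 - 1, (cantorUnpair m).2 + 1)

/-- The start of the next antidiagonal; with the rule along an antidiagonal below, this is the
recursion defining `cantorUnpair`. -/
theorem cantorPair_succ_zero (k : ℕ) : cantorPair (k + 1) 0 = cantorPair 0 k + 1 := by
  have : (k + 1 + 0) * (k + 1 + 0 + 1) = (0 + k) * (0 + k + 1) + (k + 1) * 2 := by ring
  rw [cantorPair, cantorPair, this, Nat.add_mul_div_right _ _ two_pos]
  ring

theorem cantorPair_succ_right (n k : ℕ) : cantorPair n (k + 1) = cantorPair (n + 1) k + 1 := by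
  have : (n + (k + 1)) * (n + (k + 1) + 1) = (n + 1 + k) * (n + 1 + k + 1) := by ring
  rw [cantorPair, cantorPair, this]
  ring

theorem cantorUnpair_cantorPair (n k : ℕ) : cantorUnpair (cantorPair n k) = (n, k) := by
  suffices ∀ m n k, cantorPair n k = m → cantorUnpair m = (n, k) from this _ n k rfl
  intro m
  induction m with
  | zero =>
    intro n k h
    have hk : k = 0 := by rw [cantorPair] at h; omega
    subst hk
    cases n with
    | zero => rfl
    | succ n => rw [cantorPair_succ_zero] at h; omega
  | succ m ih =>
    intro n k h
    cases k with
    | zero =>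
      cases n with
      | zero => exact absurd h (by simp [cantorPair])
      | succ n =>
        rw [cantorPair_succ_zero] at h
        simp [cantorUnpair, ih 0 n (by omega)]
    | succ k =>
      rw [cantorPair_succ_right] at h
      simp [cantorUnpair, ih (n + 1) k (by omega)]

theorem primrec_cantorUnpair : Primrec cantorUnpair := by
  have h : Primrec₂ fun (_ : ℕ) (x : ℕ × ℕ) =>
      if x.1 = 0 then (x.2 + 1, 0) else (x.1 - 1, x.2 + 1) := by
    have h1 : Primrec fun y : ℕ × ℕ × ℕ => y.2.1 := Primrec.fst.comp Primrec.snd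
    have h2 : Primrec fun y : ℕ × ℕ × ℕ => y.2.2 + 1 :=
      Primrec.succ.comp (Primrec.snd.comp Primrec.snd)
    exact Primrec.ite (Primrec.eq.comp h1 (Primrec.const 0)) (Primrec.pair h2 (Primrec.const 0))
      (Primrec.pair (Primrec.nat_sub.comp h1 (Primrec.const 1)) h2)
  refine (Primrec.nat_rec₁ (0, 0) h).of_eq fun m => ?_
  induction m with
  | zero => rfl
  | succ m ih => simp only [ih]; rfl

theorem le_cantorPair_left (n k : ℕ) : n ≤ cantorPair n k := by
  induction n with
  | zero => exact Nat.zero_le _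
  | succ n ih =>
    have h1 : (n + k) * (n + k + 1) / 2 + 1 ≤ (n + 1 + k) * (n + 1 + k + 1) / 2 := by
      have : (n + 1 + k) * (n + 1 + k + 1) = (n + k) * (n + k + 1) + (n + k + 1) * 2 := by ring
      rw [this, Nat.add_mul_div_right _ _ two_pos]
      omega
    rw [cantorPair] at ih ⊢
    omega

/-! ### Extensions of finite sequences with prescribed columns -/

/-- Extend `σ` by the entries of `τ`, except that the entries in column `k` are replaced by `π k`
if `k` is less than the length of `π`. -/
def extend (σ π τ : List ℕ) : List ℕ :=
  τ.foldl (fun l x => l ++ [(π[(cantorUnpair l.length).2]?).getD x]) σ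

theorem extend_concat (σ π τ : List ℕ) (x : ℕ) : extend σ π (τ ++ [x]) =
    extend σ π τ ++ [(π[(cantorUnpair (extend σ π τ).length).2]?).getD x] := by
  rw [extend, List.foldl_append]
  rfl

theorem primrec_extend : Primrec fun x : (List ℕ × List ℕ) × List ℕ => extend x.1.1 x.1.2 x.2 := by
  have h : Primrec₂ fun (x : (List ℕ × List ℕ) × List ℕ) (y : List ℕ × ℕ) =>
      y.1 ++ [(x.1.2[(cantorUnpair y.1.length).2]?).getD y.2] :=
    Primrec.list_concat.comp (Primrec.fst.comp Primrec.snd) (Primrec.option_getD.comp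
      (Primrec.list_getElem?.comp (Primrec.snd.comp (Primrec.fst.comp Primrec.fst))
        (Primrec.snd.comp (primrec_cantorUnpair.comp
          (Primrec.list_length.comp (Primrec.fst.comp Primrec.snd)))))
      (Primrec.snd.comp Primrec.snd))
  exact Primrec.list_foldl Primrec.snd (Primrec.fst.comp Primrec.fst) h

theorem extend_length (σ π τ : List ℕ) : (extend σ π τ).length = σ.length + τ.length := by
  induction τ using List.reverseRecOn with
  | nil => rfl
  | append_singleton τ x ih => simp [extend_concat, ih, Nat.add_assoc]

theorem prefix_extend (σ π τ : List ℕ) : σ <+: extend σ π τ := by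
  induction τ using List.reverseRecOn with
  | nil => exact List.prefix_rfl
  | append_singleton τ x ih =>
    rw [extend_concat]
    exact ih.trans (List.prefix_append _ _)

theorem extend_getElem? {σ π τ : List ℕ} {m v : ℕ} (h1 : σ.length ≤ m)
    (h2 : m < (extend σ π τ).length) (hv : π[(cantorUnpair m).2]? = some v) :
    (extend σ π τ)[m]? = some v := by
  induction τ using List.reverseRecOn with
  | nil => exact absurd h2 (not_lt.2 h1)
  | append_singleton τ x ih =>
    rw [extend_concat] at h2 ⊢
    rcases lt_or_ge m (extend σ π τ).length with h | h
    · rw [List.getElem?_append_left h, ih h]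
    · rw [List.length_append, List.length_singleton] at h2
      obtain rfl : m = (extend σ π τ).length := by omega
      simp [hv]

/-- Extending by the tail of `q` itself changes nothing if `q` respects the frozen columns. Hence
every prefix of such a `q` beyond `σ` is among the extensions searched. -/
theorem extend_eq_pre {σ π : List ℕ} {q : Baire} (hσ : pre q σ.length = σ)
    (hq : ∀ m, σ.length ≤ m → ∀ v, π[(cantorUnpair m).2]? = some v → q m = v) (s : ℕ) :
    extend σ π (pre (fun j => q (σ.length + j)) s) = pre q (σ.length + s) := by
  induction s with
  | zero => exact hσ.symm
  | succ s ih =>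
    rw [pre_succ, extend_concat, ih, pre_length, ← Nat.add_assoc, pre_succ]
    congr 2
    cases h : π[(cantorUnpair (σ.length + s)).2]? with
    | none => rfl
    | some v => exact (hq _ (Nat.le_add_right _ _) v h).symm

/-! ### Low preimages under the limit map -/

/-- `τ` extends `σ` to an oracle for which program `i` halts, if the columns are as prescribed. -/
noncomputable def forcesHalt (i : ℕ) (σ π τ : List ℕ) : Bool := (run (extend σ π τ) i 0).isSome

theorem primrec_forcesHalt : Primrec fun x : ((ℕ × List ℕ) × List ℕ) × List ℕ =>
    forcesHalt x.1.1.1 x.1.1.2 x.1.2 x.2 := by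
  have h : Primrec fun x : ((ℕ × List ℕ) × List ℕ) × List ℕ => x.1.1 :=
    Primrec.fst.comp Primrec.fst
  exact Primrec.option_isSome.comp (primrec_run.comp (Primrec.pair
    (primrec_extend.comp (Primrec.pair (Primrec.pair (Primrec.snd.comp h)
      (Primrec.snd.comp Primrec.fst)) Primrec.snd))
    (Primrec.pair (Primrec.fst.comp h) (Primrec.const 0))))

/-- One step of the construction of a low preimage of `p`: it decides whether program `i` halts. -/
def IsLowStep (p : Baire) (i : ℕ) (σ σ' : List ℕ) : Prop :=
  ∃ τ, σ' = extend σ (pre p i) (τ ++ [0]) ∧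
    ((∃ τ', forcesHalt i σ (pre p i) τ' = true) → forcesHalt i σ (pre p i) τ = true)

namespace IsLowStep

variable {p : Baire} {x : ℕ → List ℕ}

theorem prefix_of_le (hx : ∀ i, IsLowStep p i (x i) (x (i + 1))) {i j : ℕ} (h : i ≤ j) :
    x i <+: x j := by
  induction j, h using Nat.le_induction with
  | base => exact List.prefix_rfl
  | succ j _ ih =>
    obtain ⟨τ, hτ, -⟩ := hx j
    rw [hτ]
    exact ih.trans (prefix_extend _ _ _)

/-- The `0` appended at each stage forces growth even for empty `τ`, so that the limit is a total
sequence. -/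
theorem le_length (hx : ∀ i, IsLowStep p i (x i) (x (i + 1))) (i : ℕ) : i ≤ (x i).length := by
  induction i with
  | zero => exact Nat.zero_le _
  | succ i ih =>
    obtain ⟨τ, hτ, -⟩ := hx i
    rw [hτ, extend_length, List.length_append, List.length_singleton]
    omega

theorem exists_limit (hx : ∀ i, IsLowStep p i (x i) (x (i + 1))) :
    ∃ q : Baire, ∀ i, pre q (x i).length = x i := by
  refine ⟨fun m => ((x (m + 1))[m]?).getD 0, fun i => ?_⟩
  refine (pre_prefix_of_getElem? fun m hm => ?_).eq_of_length (by simp)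
  have h1 : m < (x (m + 1)).length := le_length hx (m + 1)
  have h2 : (x (m + 1))[m]? = (x i)[m]? := by
    rcases le_total (m + 1) i with h | h
    · rw [List.getElem?_eq_getElem h1,
        (List.prefix_iff_getElem?.1 (prefix_of_le hx h)) m h1]
    · rw [List.getElem?_eq_getElem hm,
        (List.prefix_iff_getElem?.1 (prefix_of_le hx h)) m hm]
  rw [h2, List.getElem?_eq_getElem hm]
  rfl

/-- Every position beyond `x i` is filled at a stage `j ≥ i`, where all columns below `j` are frozen
to the values of `p`. -/
theorem limit_apply (hx : ∀ i, IsLowStep p i (x i) (x (i + 1))) {q : Baire}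
    (hq : ∀ i, pre q (x i).length = x i) {i m : ℕ} (hm : (x i).length ≤ m)
    (hi : (cantorUnpair m).2 < i) : q m = p (cantorUnpair m).2 := by
  have key : ∀ j, i ≤ j → m < (x j).length → (x j)[m]? = some (p (cantorUnpair m).2) := by
    intro j hj
    induction j, hj using Nat.le_induction with
    | base => exact fun h => absurd h (not_lt.2 hm)
    | succ j hj ih =>
      intro h
      rcases lt_or_ge m (x j).length with h1 | h1
      · rw [← ih h1, List.getElem?_eq_getElem h1,
          (List.prefix_iff_getElem?.1 (prefix_of_le hx j.le_succ)) m h1]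
      · obtain ⟨τ, hτ, -⟩ := hx j
        rw [hτ] at h ⊢
        exact extend_getElem? h1 h (pre_getElem? p (by omega))
  have hlen : m < (x (m + i + 1)).length :=
    lt_of_lt_of_le (by omega) (le_length hx (m + i + 1))
  have := key (m + i + 1) (by omega) hlen
  rw [← hq] at this
  exact eq_of_pre_getElem? this

theorem mem_limMap (hx : ∀ i, IsLowStep p i (x i) (x (i + 1))) {q : Baire}
    (hq : ∀ i, pre q (x i).length = x i) : p ∈ limMap q := by
  rw [mem_limMap_iff_eventually]
  intro k
  filter_upwards [eventually_ge_atTop (x (k + 1)).length] with r hr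
  have h := limit_apply hx hq (i := k + 1) (m := cantorPair r k)
    (hr.trans (le_cantorPair_left r k)) (by rw [cantorUnpair_cantorPair]; exact k.lt_succ_self)
  rwa [cantorUnpair_cantorPair] at h

/-- The forcing property: if program `i` halts on `q`, the tail of `q` is a witness at stage `i`;
conversely, if a witness exists, stage `i` has put one into `q`. -/
theorem haltsOn_iff (hx : ∀ i, IsLowStep p i (x i) (x (i + 1))) {q : Baire}
    (hq : ∀ i, pre q (x i).length = x i) (i : ℕ) :
    HaltsOn (Code.ofNatCode i) q ↔ ∃ τ, forcesHalt i (x i) (pre p i) τ = true := by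
  rw [haltsOn_iff_run]
  constructor
  · rintro ⟨s, hs⟩
    refine ⟨pre (fun j => q ((x i).length + j)) s, ?_⟩
    rw [forcesHalt, extend_eq_pre (hq i)]
    · obtain ⟨v, hv⟩ := Option.isSome_iff_exists.1 hs
      rw [run_mono (pre_prefix q (Nat.le_add_left s _)) hv]
      rfl
    · intro m hm v hv
      have hi : (cantorUnpair m).2 < i := by
        simpa using (List.getElem?_eq_some_iff.1 hv).1
      rw [limit_apply hx hq hm hi, eq_of_pre_getElem? hv]
  · intro h
    obtain ⟨τ, hτ, hf⟩ := hx i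
    obtain ⟨v, hv⟩ := Option.isSome_iff_exists.1 (hf h)
    refine ⟨(x (i + 1)).length, ?_⟩
    rw [hq, hτ, run_mono _ hv]
    · rfl
    · rw [extend_concat]
      exact List.prefix_append _ _

end IsLowStep

theorem join_two_mul (r p : Baire) (n : ℕ) : join r p (2 * n) = r n := by
  simp [join]

theorem join_two_mul_add_one (r p : Baire) (n : ℕ) : join r p (2 * n + 1) = p n := by
  have h1 : (2 * n + 1) % 2 = 1 := by omega
  have h2 : (2 * n + 1) / 2 = n := by omega
  simp [join, h1, h2]

/-- The existence of a forcing `τ` is semidecidable without oracle: `τ` is decoded from the prefix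
length alone. So one query to `0'`, at an even position of the join, decides it, and for the
constructed `q` the answer is also a bit of `J q`. -/
theorem exists_forcesHalt_code : ∃ d : Code, ∀ p (x : (ℕ × List ℕ) × List ℕ),
    ∃ b, b ∈ d.eval (join haltingProblem p) (Encodable.encode x) ∧ ∀ q,
      ((HaltsOn (Code.ofNatCode x.1.1) q ↔ ∃ τ, forcesHalt x.1.1 x.1.2 x.2 τ = true) →
        b = jump q x.1.1) ∧ (b = 0 ↔ ¬ ∃ τ, forcesHalt x.1.1 x.1.2 x.2 τ = true) := by
  obtain ⟨f, hf, hs⟩ := exists_index (g := fun ρ m =>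
      forcesHalt (Denumerable.ofNat ((ℕ × List ℕ) × List ℕ) m).1.1
        (Denumerable.ofNat ((ℕ × List ℕ) × List ℕ) m).1.2
        (Denumerable.ofNat ((ℕ × List ℕ) × List ℕ) m).2
        (Denumerable.ofNat (List ℕ) ρ.length))
    (primrec_forcesHalt.comp (Primrec.pair ((Primrec.ofNat _).comp Primrec.snd)
      ((Primrec.ofNat _).comp (Primrec.list_length.comp Primrec.fst)))).to_comp
  obtain ⟨e, he⟩ := Code.exists_of_computable
    (f := fun x : (ℕ × List ℕ) × List ℕ => 2 * f (Encodable.encode x))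
    ((Primrec.nat_mul.comp (Primrec.const 2) Primrec.id).to_comp.comp
      (hf.comp Computable.encode))
  refine ⟨.comp .oracle e, fun p x => ⟨haltingProblem (f (Encodable.encode x)), ?_, fun q => ?_⟩⟩
  · refine Code.mem_eval_comp (he _ x) ?_
    simpa [join_two_mul] using
      Code.mem_eval_oracle (join haltingProblem p) (2 * f (Encodable.encode x))
  · have hex : (∃ s, forcesHalt x.1.1 x.1.2 x.2 (Denumerable.ofNat (List ℕ) s) = true) ↔
        ∃ τ, forcesHalt x.1.1 x.1.2 x.2 τ = true :=
      ⟨fun ⟨s, h⟩ => ⟨_, h⟩, fun ⟨τ, h⟩ => ⟨Encodable.encode τ, by simpa using h⟩⟩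
    have h1 := (hs (fun _ => 0) (Encodable.encode x)).1
    have h0 := (hs (fun _ => 0) (Encodable.encode x)).2
    simp only [Denumerable.ofNat_encode, pre_length] at h1 h0
    rw [hex] at h1
    have h0' : haltingProblem (f (Encodable.encode x)) = 0 ↔
        ¬ ∃ τ, forcesHalt x.1.1 x.1.2 x.2 τ = true := by
      rw [← hex, haltingProblem, h0]
      simp
    refine ⟨fun hq => ?_, h0'⟩
    by_cases h : ∃ τ, forcesHalt x.1.1 x.1.2 x.2 τ = true
    · rw [jump_eq_one_iff.2 (hq.2 h), haltingProblem, h1.2 h]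
    · rw [jump_eq_zero_iff.2 (mt hq.1 h), h0'.2 h]

/-- The bit `b` makes the search terminate: for `b = 0` any `τ` is accepted, otherwise a forcing one
exists. -/
theorem exists_search_forcesHalt_code : ∃ c : Code, ∀ p (x : (ℕ × List ℕ) × List ℕ) (b : ℕ),
    (b = 0 ↔ ¬ ∃ τ, forcesHalt x.1.1 x.1.2 x.2 τ = true) →
    ∃ τ, Encodable.encode (extend x.1.2 x.2 (τ ++ [0])) ∈ c.eval p (Encodable.encode (x, b)) ∧
      ((∃ τ', forcesHalt x.1.1 x.1.2 x.2 τ' = true) → forcesHalt x.1.1 x.1.2 x.2 τ = true) := by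
  let g (τ : List ℕ) (y : ((ℕ × List ℕ) × List ℕ) × ℕ) : Option ℕ :=
    bif (y.2 == 0) || forcesHalt y.1.1.1 y.1.1.2 y.1.2 τ then
      some (Encodable.encode (extend y.1.1.2 y.1.2 (τ ++ [0])))
    else none
  have hg : Primrec₂ g := by
    have hy : Primrec fun z : List ℕ × ((ℕ × List ℕ) × List ℕ) × ℕ => z.2.1 :=
      Primrec.fst.comp Primrec.snd
    have h0 : Primrec fun z : List ℕ × ((ℕ × List ℕ) × List ℕ) × ℕ => z.2.2 == 0 :=
      Primrec.beq.comp (Primrec.snd.comp Primrec.snd) (Primrec.const 0)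
    have h1 := primrec_forcesHalt.comp (Primrec.pair hy Primrec.fst)
    have h2 := primrec_extend.comp (Primrec.pair
        (Primrec.pair (Primrec.snd.comp (Primrec.fst.comp hy)) (Primrec.snd.comp hy))
        (Primrec.list_concat.comp Primrec.fst (Primrec.const 0)))
    exact Primrec.cond (Primrec.or.comp h0 h1)
      (Primrec.option_some.comp (Primrec.encode.comp h2)) (Primrec.const none)
  obtain ⟨c, hc⟩ := Code.exists_search
    (g := fun σ n => g (Denumerable.ofNat (List ℕ) σ.length)
      (Denumerable.ofNat (((ℕ × List ℕ) × List ℕ) × ℕ) n))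
    (hg.comp ((Primrec.ofNat _).comp (Primrec.list_length.comp Primrec.fst))
      ((Primrec.ofNat _).comp Primrec.snd)).to_comp
  refine ⟨c, fun p x b hb => ?_⟩
  have hdom : (c.eval p (Encodable.encode (x, b))).Dom := by
    refine (hc p _).2 ?_
    simp only [Denumerable.ofNat_encode, g, pre_length]
    by_cases h : ∃ τ, forcesHalt x.1.1 x.1.2 x.2 τ = true
    · obtain ⟨τ, hτ⟩ := h
      exact ⟨Encodable.encode τ, by simp [hτ]⟩
    · exact ⟨0, by simp [hb.2 h]⟩
  obtain ⟨v, hv⟩ := Part.dom_iff_mem.1 hdom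
  obtain ⟨s, hs⟩ := (hc p _).1 v hv
  simp only [Denumerable.ofNat_encode, g, pre_length] at hs
  refine ⟨Denumerable.ofNat (List ℕ) s, ?_, fun h => ?_⟩
  · cases hcond : (b == 0) || forcesHalt x.1.1 x.1.2 x.2 (Denumerable.ofNat (List ℕ) s)
    · simp [hcond] at hs
    · rw [hcond, cond_true, Option.some_inj] at hs
      rwa [hs]
  · have hb0 : b ≠ 0 := fun h0 => hb.1 h0 h
    by_contra hne
    rw [Bool.not_eq_true] at hne
    rw [hne, Bool.or_false, beq_eq_false_iff_ne.2 hb0] at hs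
    cases hs

/-- Every `p` has a preimage under the limit map whose jump is computable from `0'` and `p`,
uniformly in `p`. -/
theorem exists_low_preimage : ∃ d : Code, ∀ p : Baire, ∃ q : Baire, p ∈ limMap q ∧
    ∀ n, jump q n ∈ d.eval (join haltingProblem p) n := by
  obtain ⟨ca, hca⟩ := exists_forcesHalt_code
  obtain ⟨cs, hcs⟩ := exists_search_forcesHalt_code
  obtain ⟨e, he⟩ := Code.exists_of_computable (f := fun n : ℕ => 2 * n + 1)
    (Primrec.succ.comp (Primrec.nat_mul.comp (Primrec.const 2) Primrec.id)).to_comp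
  obtain ⟨cp, hcp⟩ := Code.exists_pre (.comp .oracle e)
  have hcp' : ∀ r p n, Encodable.encode (pre p n) ∈ cp.eval (join r p) n := fun r p =>
    hcp (join r p) p fun s => Code.mem_eval_comp (he _ s) (by
      simpa [join_two_mul_add_one] using Code.mem_eval_oracle (join r p) (2 * s + 1))
  let cx : Code := .pair Code.id (.comp cp .left)
  have hcx : ∀ p i σ, Encodable.encode (((i, σ), pre p i) : (ℕ × List ℕ) × List ℕ) ∈
      cx.eval (join haltingProblem p) (Nat.pair i (Encodable.encode σ)) := fun p i σ =>
    Code.mem_eval_pair (Code.mem_eval_id _ _)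
      (Code.mem_eval_comp (Code.mem_eval_left _ _ _) (hcp' _ _ _))
  have step : ∀ p i σ, ∃ σ', IsLowStep p i σ σ' ∧ Encodable.encode σ' ∈
      (Code.comp cs (.pair cx (.comp ca cx))).eval (join haltingProblem p)
        (Nat.pair i (Encodable.encode σ)) := by
    intro p i σ
    obtain ⟨b, hb, hbs⟩ := hca p ((i, σ), pre p i)
    obtain ⟨τ, hτ, hf⟩ := hcs (join haltingProblem p) ((i, σ), pre p i) b (hbs p).2
    exact ⟨_, ⟨τ, rfl, hf⟩, Code.mem_eval_comp (Code.mem_eval_pair (hcx p i σ)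
      (Code.mem_eval_comp (hcx p i σ) hb)) hτ⟩
  choose next hnext hmem using step
  obtain ⟨ci, hci⟩ := Code.exists_iterate (.comp cs (.pair cx (.comp ca cx)))
    (Encodable.encode ([] : List ℕ))
  -- To find bit `n` of the jump, compute stage `n` by iteration and ask its halting question again.
  refine ⟨.comp (.comp ca cx) (.pair Code.id ci), fun p => ?_⟩
  let x : ℕ → List ℕ := fun n => Nat.rec [] (fun i σ => next p i σ) n
  have hx : ∀ i, IsLowStep p i (x i) (x (i + 1)) := fun i => hnext p i (x i)
  obtain ⟨q, hq⟩ := IsLowStep.exists_limit hx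
  refine ⟨q, IsLowStep.mem_limMap hx hq, fun n => ?_⟩
  have hxn := hci (join haltingProblem p) (fun n => Encodable.encode (x n)) rfl
    (fun i => hmem p i (x i)) n
  obtain ⟨b, hb, hbs⟩ := hca p ((n, x n), pre p n)
  have hbq : b = jump q n := (hbs q).1 (IsLowStep.haltsOn_iff hx hq n)
  subst hbq
  exact Code.mem_eval_comp (Code.mem_eval_pair (Code.mem_eval_id _ _) hxn)
    (Code.mem_eval_comp (hcx p n (x n)) hb)

/-! ### Composition with `H` -/

namespace Code

/-- Replace the oracle by a program. -/
def substOracle (d : Code) : Code → Code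
  | zero => zero
  | succ => succ
  | left => left
  | right => right
  | oracle => d
  | pair cf cg => pair (substOracle d cf) (substOracle d cg)
  | comp cf cg => comp (substOracle d cf) (substOracle d cg)
  | prec cf cg => prec (substOracle d cf) (substOracle d cg)
  | rfind' cf => rfind' (substOracle d cf)

theorem eval_substOracle (p : Baire) (d c : Code) :
    eval p (substOracle d c) = evalWith (eval p d) c := by
  induction c with
  | zero | succ | left | right | oracle => rfl
  | pair cf cg hf hg => rw [substOracle, eval, hf, hg]; rfl
  | comp cf cg hf hg => rw [substOracle, eval, hf, hg]; rfl
  | prec cf cg hf hg => rw [substOracle, eval, hf, hg]; rfl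
  | rfind' cf hf => rw [substOracle, eval, hf]; rfl

theorem mem_eval_substOracle {p q : Baire} {d c : Code} (hd : ∀ n, q n ∈ eval p d n) {n v : ℕ}
    (h : v ∈ eval q c n) : v ∈ eval p (substOracle d c) n := by
  rw [eval_eq_evalWith] at h
  rw [eval_substOracle]
  refine evalWith_mono (fun m w hw => ?_) c n v h
  simp only [PFun.coe_val, Part.mem_some_iff] at hw
  exact hw ▸ hd m

end Code

theorem mem_H {p y : Baire} : y ∈ H p ↔ ∃ q, p ∈ limMap q ∧ y = jump q := by
  constructor
  · rintro ⟨-, q, hq, hy⟩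
    exact ⟨q, hq, Part.mem_some_iff.1 hy⟩
  · rintro ⟨q, hq, rfl⟩
    exact ⟨⟨⟨q, hq⟩, fun q' _ => ⟨jump q', Part.mem_some _⟩⟩, q, hq, Part.mem_some _⟩

theorem IsLimitComputable.exists_isComputable_jump {K : Baire →. Baire}
    (hK : IsLimitComputable K) :
    ∃ G : Baire →. Baire, IsComputable G ∧ ∀ q x, x ∈ G (jump q) ↔ x ∈ K q := by
  obtain ⟨d, hd⟩ := hK.exists_code_jump
  -- Restricting the domain to the jumps of points of `dom K` is what later yields equality of
  -- domains.
  let G : Baire →. Baire := fun y => ⟨∃ x q, y = jump q ∧ x ∈ K q, fun h => h.choose⟩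
  refine ⟨G, ⟨d, fun y h n => ?_⟩, fun q x => ?_⟩
  · obtain ⟨q, hy, hx⟩ := h.choose_spec
    have := hd q _ hx n
    rw [← hy] at this
    exact this
  · constructor
    · rintro ⟨h, rfl⟩
      obtain ⟨q', hq, hx⟩ := h.choose_spec
      rw [← jump_injective hq] at hx
      exact hx
    · intro hx
      have h : ∃ x q', jump q = jump q' ∧ x ∈ K q' := ⟨x, q, rfl, hx⟩
      refine ⟨h, ?_⟩
      obtain ⟨q', hq, hx'⟩ := h.choose_spec
      rw [← jump_injective hq] at hx'
      exact Part.mem_unique hx' hx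

theorem IsLimitComputable.exists_eq_comp_H {F : Baire →. Baire}
    (hF : IsLimitComputable (F.comp limMap)) : ∃ G : Baire →. Baire, IsComputable G ∧
      Multi.ofPFun F = Multi.comp (Multi.ofPFun G) H := by
  obtain ⟨G, hG, h⟩ := hF.exists_isComputable_jump
  have mem_iff : ∀ {q x}, x ∈ G (jump q) ↔ ∃ p ∈ limMap q, x ∈ F p := fun {q x} =>
    (h q x).trans Part.mem_bind_iff
  refine ⟨G, hG, ?_⟩
  funext p
  ext x
  constructor
  · intro hx
    -- Only surjectivity of `lim` is used here, to make `H p` nonempty.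
    obtain ⟨d, hd⟩ := exists_low_preimage
    obtain ⟨q, hq, -⟩ := hd p
    refine ⟨⟨⟨jump q, mem_H.2 ⟨q, hq, rfl⟩⟩, ?_⟩, jump q, mem_H.2 ⟨q, hq, rfl⟩,
      mem_iff.2 ⟨p, hq, hx⟩⟩
    rintro y hy
    obtain ⟨q', hq', rfl⟩ := mem_H.1 hy
    exact ⟨x, mem_iff.2 ⟨p, hq', hx⟩⟩
  · rintro ⟨-, y, hy, hx⟩
    obtain ⟨q, hq, rfl⟩ := mem_H.1 hy
    obtain ⟨p', hp', hx⟩ := mem_iff.1 hx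
    rw [Part.mem_unique hq hp']
    exact hx

/-- All elements of `H p` lead to the value `F p`, so it suffices to follow the single `J q`
computed from `⟨0', p⟩`; its program replaces the oracle in the program of `G`. -/
theorem isComputableRelativeTo_of_eq_comp_H {F G : Baire →. Baire} (hG : IsComputable G)
    (h : Multi.ofPFun F = Multi.comp (Multi.ofPFun G) H) :
    IsComputableRelativeTo haltingProblem F := by
  obtain ⟨c, hc⟩ := hG
  obtain ⟨d, hd⟩ := exists_low_preimage
  refine isComputableRelativeTo_iff.2 ⟨Code.substOracle d c, fun p x hx n => ?_⟩
  obtain ⟨q, hq, hJ⟩ := hd p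
  have hx' : x ∈ Multi.comp (Multi.ofPFun G) H p := h ▸ hx
  obtain ⟨z, hz⟩ := hx'.1.2 (mem_H.2 ⟨q, hq, rfl⟩)
  have hzF : z ∈ Multi.ofPFun F p :=
    h.symm ▸ ⟨hx'.1, jump q, mem_H.2 ⟨q, hq, rfl⟩, hz⟩
  obtain rfl : z = x := Part.mem_unique hzF hx
  obtain ⟨hdom, rfl⟩ := hz
  exact Code.mem_eval_substOracle hJ (hc _ hdom n)

end LimitComp

/-! ### The main theorem -/

theorem theorem3p2 (F : (ℕ → ℕ) →. (ℕ → ℕ)) :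
    (LimitComp.IsComputableRelativeTo LimitComp.haltingProblem F ↔
      ∃ G : (ℕ → ℕ) →. (ℕ → ℕ), LimitComp.IsComputable G ∧
        LimitComp.Multi.ofPFun F = LimitComp.Multi.comp (LimitComp.Multi.ofPFun G) LimitComp.H) ∧
    (LimitComp.IsComputableRelativeTo LimitComp.haltingProblem F ↔
      ∀ G : (ℕ → ℕ) →. (ℕ → ℕ), LimitComp.IsLimitComputable G →
        LimitComp.IsLimitComputable (F.comp G)) := by
  refine ⟨⟨fun hF => ?_, fun ⟨G, hG, h⟩ => ?_⟩, fun hF G hG => ?_, fun h => ?_⟩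
  · exact (hF.comp_isLimitComputable LimitComp.isLimitComputable_limMap).exists_eq_comp_H
  · exact LimitComp.isComputableRelativeTo_of_eq_comp_H hG h
  · exact hF.comp_isLimitComputable hG
  · obtain ⟨G, hG, hF⟩ := (h _ LimitComp.isLimitComputable_limMap).exists_eq_comp_H
    exact LimitComp.isComputableRelativeTo_of_eq_comp_H hG hF
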